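/- Let $G$ be a finite abelian group with Haar probability measure $\mu_G$, so $\mu_G(S)=|S|/|G|$, and let $d\ge 1$ be real. A Bourgain system $\mathcal B$ of dimension $d$ is a family $(B_\rho)_{\rho\in(0,2]}$ of subsets of $G$ such that: $B_{\rho'}\subseteq B_\rho$ whenever $\rho'\le\rho$; $0\in B_\rho$ for all $\rho$; $B_\rho=-B_\rho$ for all $\rho$; $B_\rho+B_{\rho'}\subseteq B_{\rho+\rho'}$ whenever $\rho+\rho'\le 1$; and for each $\rho\le 1$ there is a set $X\subseteq G$ with $|X|\le 2^d$ and $B_{2\rho}\subseteq\bigcup_{x\in X}(x+B_\rho)$. Its density is $\mu_G(\mathcal B):=\mu_G(B_1)$. It is regular if $$1-2^3d|\eta|\le\frac{\mu_G(B_1)}{\mu_G(B_{1+\eta})}\le 1+2^3d|\eta|\qquad\text{for all real }\eta\text{ with } d|\eta|\le 2^{-3}.$$ Let $\beta$ be the uniform probability measure on $B_1$, so $f*\beta(y)=|B_1|^{-1}\sum_{x\in B_1}f(y-x)$, and put $$\Lambda(f,g,h):=\frac1{|G|^2}\sum_{x,y\in G}f(x-y)\,g(x)\,h(x+y).$$ **Theorem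 5.1.** Let $\mathcal B$ be a regular Bourgain system of dimension $d$ in $G$. Suppose that $A\subseteq G$ has $\alpha:=\|1_A*\beta\|_{L^\infty(\mu_G)}>0$ and that $A-A$ contains no elements of order $2$. Put $L:=\max\{\log\alpha^{-1},\,2^{-12}\}$, with $\log$ the natural logarithm. Then $$\Lambda(1_A,1_A,1_A)\ \ge\ \left(\frac{\alpha}{2(1+d)}\right)^{2^{24}dL+2^{52}\alpha^{-3}L^2}\mu_G(\mathcal B)^2 .$$ In particular, if $\alpha\le 1-2^{-12}$ then $$\Lambda(1_A,1_A,1_A)\ \ge\ \left(\frac{\alpha}{2(1+d)}\right)^{2^{24}d\log\alpha^{-1}+2^{52}\alpha^{-3}(\log\alpha^{-1})^2}\mu_G(\mathcal B)^2 .$$ -/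

import Mathlib

open scoped Pointwise

/-- `IsBourgainSystem d B`: the family `(B ρ)` with `ρ ∈ (0, 2]` is a Bourgain system of
dimension `d` in the finite abelian group `G`. Only the values of `B` on `(0, 2]` matter. -/
structure IsBourgainSystem {G : Type*} [AddCommGroup G] [DecidableEq G]
    (d : ℝ) (B : ℝ → Finset G) : Prop where
  one_le_dim : 1 ≤ d
  nesting : ∀ ρ' ρ : ℝ, 0 < ρ' → ρ' ≤ ρ → ρ ≤ 2 → B ρ' ⊆ B ρ
  zero_mem : ∀ ρ : ℝ, 0 < ρ → ρ ≤ 2 → (0 : G) ∈ B ρ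
  symmetry : ∀ ρ : ℝ, 0 < ρ → ρ ≤ 2 → ∀ x ∈ B ρ, -x ∈ B ρ
  addition : ∀ ρ ρ' : ℝ, 0 < ρ → 0 < ρ' → ρ + ρ' ≤ 1 → B ρ + B ρ' ⊆ B (ρ + ρ')
  doubling : ∀ ρ : ℝ, 0 < ρ → ρ ≤ 1 →
    ∃ X : Finset G, (X.card : ℝ) ≤ (2 : ℝ) ^ d ∧ B (2 * ρ) ⊆ X + B ρ

/-- The Haar probability measure `μ_G(S)` of a subset `S` of a finite group. -/
noncomputable def haarProb {G : Type*} [Fintype G] (S : Finset G) : ℝ :=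
  (S.card : ℝ) / (Fintype.card G : ℝ)

/-- The density `μ_G(B₁)` of a Bourgain system. -/
noncomputable def bourgainDensity {G : Type*} [Fintype G] (B : ℝ → Finset G) : ℝ :=
  haarProb (B 1)

/-- A regular Bourgain system of dimension `d`. -/
structure IsRegularBourgainSystem {G : Type*} [AddCommGroup G] [Fintype G] [DecidableEq G]
    (d : ℝ) (B : ℝ → Finset G) : Prop extends IsBourgainSystem d B where
  regular : ∀ η : ℝ, d * |η| ≤ 1 / 2 ^ 3 →
    1 - 2 ^ 3 * d * |η| ≤ haarProb (B 1) / haarProb (B (1 + η)) ∧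
      haarProb (B 1) / haarProb (B (1 + η)) ≤ 1 + 2 ^ 3 * d * |η|

/-- The convolution `f * β` of `f` with the normalized counting measure `β` on the finite
set `S`, that is `y ↦ ∫ f (y - x) dβ(x)`. -/
noncomputable def convUniform {G : Type*} [AddCommGroup G]
    (f : G → ℝ) (S : Finset G) : G → ℝ :=
  fun y => (S.card : ℝ)⁻¹ * ∑ x ∈ S, f (y - x)

/-- The indicator function `1_A`. -/
noncomputable def indicatorFun {G : Type*} (A : Finset G) : G → ℝ :=
  (A : Set G).indicator 1

/-- The trilinear form `Λ(f, g, h) = ∫∫ f (x - y) g x h (x + y) dμ_G(x) dμ_G(y)`. -/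
noncomputable def tripleForm {G : Type*} [AddCommGroup G] [Fintype G]
    (f g h : G → ℝ) : ℝ :=
  ((Fintype.card G : ℝ) ^ 2)⁻¹ * ∑ y : G, ∑ x : G, f (x - y) * g x * h (x + y)

open scoped ComplexConjugate

universe u

/-! This is a density increment argument of Roth and Bourgain type, run on systems of nested sets.
Suppose `A` has density `α` on a translate of `B 1`. Averaging finds one translate on which either
`A` is already denser, or `A` has density close to `α` both on `B ρ` and on a much narrower `B ρ'`.
Progressions whose middle term lies in the narrow slice are solutions of `x + y = 2b`, with `x, y`
in the wide slice and `b` in the narrow one. As `A - A` has no element of order 2, doubling is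
injective on `A`, so the set `A'` of the doubles `2b` is as large as the narrow slice.

Fourier analysis gives two cases (`many_solutions_or_large_energy`): about `α³|B ρ||B ρ'|`
solutions, or a large `L²` mass of the balanced function on the large spectrum of `A'`. By a local
Bessel inequality, that spectrum lies in `O(α⁻³)` translates of the large spectrum of the doubled
set `2·B ρ'` (`exists_spectrum_cover`). At a regular scale, characters of the latter are nearly
trivial on a narrow doubled set. Intersecting narrow doubled sets with Bohr sets of `O(α⁻³)`
frequencies therefore makes the whole spectrum of `A'` nearly trivial, and the `L²` mass becomes a
density of at least `17/16 α` on a translate of the new system (`exists_increment_of_large_energy`).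

Each step adds `O(α⁻³)` to the dimension while `α` grows geometrically, so the dimension stays `O(d
+ α⁻³)`. Density cannot exceed 1, so there are `O(L)` steps, and multiplying their losses gives the
bound (`le_count_of_hasDensity`).

Partitions into cells with small differences replace covers by translates because they survive the
two operations needed: cells transfer to doubled sets, and intersecting with a Bohr set takes
products of partitions. -/

/-- A family `(B r)` with `r ∈ (0, 1]` of symmetric nested sets in which each `B (2 * r)` splits
into at most `2 ^ D` cells whose difference sets lie in `B r`. -/
structure CellSystem {G : Type u} [AddCommGroup G] (D : ℝ) (B : ℝ → Finset G) : Prop where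
  mono : ∀ {s r : ℝ}, 0 < s → s ≤ r → r ≤ 1 → B s ⊆ B r
  zero_mem : ∀ {r : ℝ}, 0 < r → r ≤ 1 → (0 : G) ∈ B r
  neg_mem : ∀ {r : ℝ} {x : G}, 0 < r → r ≤ 1 → x ∈ B r → -x ∈ B r
  add_mem : ∀ {r s : ℝ} {x y : G}, 0 < r → 0 < s → r + s ≤ 1 → x ∈ B r → y ∈ B s →
    x + y ∈ B (r + s)
  cells : ∀ {r : ℝ}, 0 < r → 2 * r ≤ 1 → ∃ (ι : Type u) (T : Finset ι) (φ : G → ι),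
    (T.card : ℝ) ≤ (2 : ℝ) ^ D ∧ (∀ x ∈ B (2 * r), φ x ∈ T) ∧
      ∀ x ∈ B (2 * r), ∀ y ∈ B (2 * r), φ x = φ y → x - y ∈ B r

/-! ### Systems with cells: sizes, dilates, doubled sets -/

section Cells

variable {G : Type u} [AddCommGroup G]

/-- A set that splits into cells, each with differences in `S`, has at most as many elements
as there are cells times the size of `S`. -/
theorem card_le_card_mul_card_of_cells {ι : Type*} (R S : Finset G) (T : Finset ι) (φ : G → ι)
    (hφ : ∀ x ∈ R, φ x ∈ T) (h : ∀ x ∈ R, ∀ y ∈ R, φ x = φ y → x - y ∈ S) :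
    R.card ≤ T.card * S.card := by
  classical
  rw [mul_comm]
  refine Finset.card_le_mul_card_image_of_maps_to hφ _ fun b _ => ?_
  rcases (R.filter fun a => φ a = b).eq_empty_or_nonempty with h0 | ⟨y, hy⟩
  · simp [h0]
  · rw [Finset.mem_filter] at hy
    refine Finset.card_le_card_of_injOn (fun x => x - y) (fun x hx => ?_) fun x _ x' _ hxx => ?_
    · have hx' := Finset.mem_filter.1 (Finset.mem_coe.1 hx)
      exact h x hx'.1 y hy.1 (hx'.2.trans hy.2.symm)
    · simpa using hxx

variable {D : ℝ} {B : ℝ → Finset G}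

namespace CellSystem

theorem card_pos (hB : CellSystem D B) {r : ℝ} (h0 : 0 < r) (h1 : r ≤ 1) :
    (0 : ℝ) < (B r).card :=
  Nat.cast_pos.2 (Finset.card_pos.2 ⟨0, hB.zero_mem h0 h1⟩)

theorem card_mono (hB : CellSystem D B) {s r : ℝ} (h0 : 0 < s) (h : s ≤ r) (h1 : r ≤ 1) :
    ((B s).card : ℝ) ≤ (B r).card :=
  Nat.cast_le.2 (Finset.card_le_card (hB.mono h0 h h1))

theorem add_mem_of_le (hB : CellSystem D B) {r s t : ℝ} {x y : G} (hr : 0 < r) (hs : 0 < s)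
    (h : r + s ≤ t) (ht : t ≤ 1) (hx : x ∈ B r) (hy : y ∈ B s) : x + y ∈ B t :=
  hB.mono (by linarith) h ht (hB.add_mem hr hs (by linarith) hx hy)

theorem card_double (hB : CellSystem D B) {r : ℝ} (h0 : 0 < r) (h1 : 2 * r ≤ 1) :
    ((B (2 * r)).card : ℝ) ≤ (2 : ℝ) ^ D * (B r).card := by
  obtain ⟨ι, T, φ, hT, hφ, h⟩ := hB.cells h0 h1
  have := card_le_card_mul_card_of_cells _ _ T φ hφ h
  calc ((B (2 * r)).card : ℝ) ≤ T.card * (B r).card := by exact_mod_cast this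
    _ ≤ _ := by gcongr

theorem card_le_pow (hB : CellSystem D B) (n : ℕ) {r s : ℝ}
    (hr : 0 < r) (hr1 : r ≤ 1) (hs1 : s ≤ 1) (h : r ≤ 2 ^ n * s) :
    ((B r).card : ℝ) ≤ ((2 : ℝ) ^ n) ^ D * (B s).card := by
  induction n generalizing r with
  | zero =>
    simp only [pow_zero, one_mul] at h
    simpa using hB.card_mono hr h hs1
  | succ n ih =>
    have h1 := hB.card_double (r := r / 2) (by positivity) (by linarith)
    have h2 := ih (r := r / 2) (by positivity) (by linarith) (by rw [pow_succ] at h; linarith)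
    rw [show 2 * (r / 2) = r by ring] at h1
    calc ((B r).card : ℝ) ≤ (2 : ℝ) ^ D * (B (r / 2)).card := h1
      _ ≤ (2 : ℝ) ^ D * (((2 : ℝ) ^ n) ^ D * (B s).card) := by gcongr
      _ = ((2 : ℝ) ^ (n + 1)) ^ D * (B s).card := by
        rw [pow_succ, Real.mul_rpow (by positivity) (by positivity)]; ring

theorem card_dilate (hB : CellSystem D B) (hD : 0 ≤ D) {r s : ℝ} (hs : 0 < s) (hsr : s ≤ r)
    (hr1 : r ≤ 1) : ((B r).card : ℝ) ≤ (2 * r / s) ^ D * (B s).card := by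
  have hr : 0 < r := hs.trans_le hsr
  obtain ⟨n, hn, hn'⟩ := exists_nat_pow_near (x := r / s) (y := 2) ((one_le_div hs).2 hsr)
    one_lt_two
  refine (hB.card_le_pow (n + 1) hr hr1 (hsr.trans hr1) ((div_le_iff₀ hs).1 hn'.le)).trans ?_
  gcongr
  rw [pow_succ, mul_div_assoc]
  linarith

theorem mul_card_le (hB : CellSystem D B) (hD : 0 ≤ D) {r s : ℝ} (hs : 0 < s) (hsr : s ≤ r)
    (hr1 : r ≤ 1) : (s / (2 * r)) ^ D * (B r).card ≤ ((B s).card : ℝ) := by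
  have hr : 0 < r := hs.trans_le hsr
  have h := hB.card_dilate hD hs hsr hr1
  calc (s / (2 * r)) ^ D * (B r).card
      ≤ (s / (2 * r)) ^ D * ((2 * r / s) ^ D * (B s).card) := by gcongr
    _ = (B s).card := by
      rw [← mul_assoc, ← Real.mul_rpow (by positivity) (by positivity),
        show s / (2 * r) * (2 * r / s) = 1 by field_simp, Real.one_rpow, one_mul]

theorem dilate (hB : CellSystem D B) {σ : ℝ} (h0 : 0 < σ) (h1 : σ ≤ 1) :
    CellSystem D fun r => B (σ * r) where
  mono := fun hs hsr hr => hB.mono (by positivity) (by gcongr) (by nlinarith)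
  zero_mem := fun h h' => hB.zero_mem (by positivity) (by nlinarith)
  neg_mem := fun h h' => hB.neg_mem (by positivity) (by nlinarith)
  add_mem := fun {r s} {_ _} h h' hrs hx hy => by
    rw [mul_add]
    exact hB.add_mem (by positivity) (by positivity) (by nlinarith) hx hy
  cells := fun {r} h h' => by
    have := hB.cells (r := σ * r) (by positivity) (by nlinarith)
    rwa [show 2 * (σ * r) = σ * (2 * r) by ring] at this

theorem mono_dim (hB : CellSystem D B) {D' : ℝ} (h : D ≤ D') : CellSystem D' B where
  mono := hB.mono
  zero_mem := hB.zero_mem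
  neg_mem := hB.neg_mem
  add_mem := hB.add_mem
  cells := fun h0 h1 => by
    obtain ⟨ι, T, φ, hT, hφ, h2⟩ := hB.cells h0 h1
    exact ⟨ι, T, φ, hT.trans (Real.rpow_le_rpow_of_exponent_le one_le_two h), hφ, h2⟩

/-- Choosing one half of each point carries the cells over with the same dimension; doubling need
not be injective on the system. -/
theorem image_double [DecidableEq G] (hB : CellSystem D B) :
    CellSystem D fun r => (B r).image fun x => x + x where
  mono := fun hs hsr hr => Finset.image_subset_image (hB.mono hs hsr hr)
  zero_mem := fun h h' => Finset.mem_image.2 ⟨0, hB.zero_mem h h', add_zero 0⟩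
  neg_mem := fun {r x} h h' hx => by
    obtain ⟨y, hy, rfl⟩ := Finset.mem_image.1 hx
    exact Finset.mem_image.2 ⟨-y, hB.neg_mem h h' hy, by abel⟩
  add_mem := fun {r s x y} h h' hrs hx hy => by
    obtain ⟨x', hx', rfl⟩ := Finset.mem_image.1 hx
    obtain ⟨y', hy', rfl⟩ := Finset.mem_image.1 hy
    exact Finset.mem_image.2 ⟨x' + y', hB.add_mem h h' hrs hx' hy', by abel⟩
  cells := fun {r} h h' => by
    obtain ⟨ι, T, φ, hT, hφ, h2⟩ := hB.cells h h'
    have hs : ∀ y : G, ∃ x : G, y ∈ (B (2 * r)).image (fun x => x + x) →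
        x ∈ B (2 * r) ∧ x + x = y := fun y => by
      by_cases hy : y ∈ (B (2 * r)).image (fun x => x + x)
      · obtain ⟨x, hx, hxy⟩ := Finset.mem_image.1 hy
        exact ⟨x, fun _ => ⟨hx, hxy⟩⟩
      · exact ⟨0, fun hy' => absurd hy' hy⟩
    choose g hg using hs
    refine ⟨ι, T, φ ∘ g, hT, fun x hx => hφ _ (hg x hx).1, fun x hx y hy hxy => ?_⟩
    refine Finset.mem_image.2 ⟨g x - g y, h2 _ (hg x hx).1 _ (hg y hy).1 hxy, ?_⟩
    have hx' := (hg x hx).2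
    have hy' := (hg y hy).2
    calc g x - g y + (g x - g y) = (g x + g x) - (g y + g y) := by abel
      _ = x - y := by rw [hx', hy']

end CellSystem

/-- Covering twice uses at most `2 ^ (2 * d)` translates of `B (r / 2)`, and two points of one
translate differ by an element of `B (r / 2) + B (r / 2) ⊆ B r`. This doubles the dimension. -/
theorem IsBourgainSystem.cellSystem [DecidableEq G] {d : ℝ} (hB : IsBourgainSystem d B) :
    CellSystem (2 * d) B where
  mono := fun hs hsr hr => hB.nesting _ _ hs hsr (by linarith)
  zero_mem := fun h h' => hB.zero_mem _ h (by linarith)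
  neg_mem := fun h h' hx => hB.symmetry _ h (by linarith) _ hx
  add_mem := fun h h' hrs hx hy => hB.addition _ _ h h' hrs (Finset.add_mem_add hx hy)
  cells := fun {r} h h' => by
    obtain ⟨X, hX, hX'⟩ := hB.doubling r h (by linarith)
    obtain ⟨Y, hY, hY'⟩ := hB.doubling (r / 2) (by linarith) (by linarith)
    rw [show 2 * (r / 2) = r by ring] at hY'
    have hcov : ∀ y : G, ∃ x : G, y ∈ B (2 * r) → x ∈ X + Y ∧ y - x ∈ B (r / 2) := fun y => by
      by_cases hy : y ∈ B (2 * r)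
      · obtain ⟨a, ha, b, hb, rfl⟩ := Finset.mem_add.1 (hX' hy)
        obtain ⟨a', ha', b', hb', rfl⟩ := Finset.mem_add.1 (hY' hb)
        exact ⟨a + a', fun _ => ⟨Finset.add_mem_add ha ha', by
          rwa [show a + (a' + b') - (a + a') = b' by abel]⟩⟩
      · exact ⟨0, fun hy' => absurd hy' hy⟩
    choose g hg using hcov
    refine ⟨G, X + Y, g, ?_, fun x hx => (hg x hx).1, fun x hx y hy hxy => ?_⟩
    · calc ((X + Y).card : ℝ) ≤ X.card * Y.card := by exact_mod_cast Finset.card_add_le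
        _ ≤ (2 : ℝ) ^ d * (2 : ℝ) ^ d := by gcongr
        _ = (2 : ℝ) ^ (2 * d) := by rw [← Real.rpow_add two_pos]; ring_nf
    · have h1 := (hg x hx).2
      have h2 := hB.symmetry _ (by linarith) (by linarith) _ (hg y hy).2
      have h3 := hB.addition (r / 2) (r / 2) (by linarith) (by linarith) (by linarith)
        (Finset.add_mem_add h1 h2)
      rw [hxy, add_halves] at h3
      rwa [show x - g y + -(y - g y) = x - y by abel] at h3

end Cells

/-! ### Intersecting a system with Bohr sets -/

section Bohr

/-- The index of the square of side `2 * r / 3` containing a complex number. -/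
noncomputable def gridCell (r : ℝ) (z : ℂ) : ℤ × ℤ :=
  (⌊z.re / (2 * r / 3)⌋, ⌊z.im / (2 * r / 3)⌋)

theorem abs_sub_lt_of_floor_eq {s a b : ℝ} (hs : 0 < s) (h : ⌊a / s⌋ = ⌊b / s⌋) :
    |a - b| < s := by
  have := Int.abs_sub_lt_one_of_floor_eq_floor h
  rwa [← sub_div, abs_div, abs_of_pos hs, div_lt_one hs] at this

/-- A square of side `2r/3` has diagonal `2√2r/3 < r`. -/
theorem norm_sub_le_of_gridCell_eq {r : ℝ} (hr : 0 < r) {z w : ℂ}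
    (h : gridCell r z = gridCell r w) : ‖z - w‖ ≤ r := by
  have h1 := abs_sub_lt_of_floor_eq (by positivity) (Prod.ext_iff.1 h).1
  have h2 := abs_sub_lt_of_floor_eq (by positivity) (Prod.ext_iff.1 h).2
  refine abs_le_of_sq_le_sq' ?_ hr.le |>.2
  rw [Complex.sq_norm, Complex.normSq_apply, Complex.sub_re, Complex.sub_im]
  have h3 := sq_le_sq' (by linarith [abs_nonneg (z.re - w.re)]) h1.le
  have h4 := sq_le_sq' (by linarith [abs_nonneg (z.im - w.im)]) h2.le
  rw [sq_abs] at h3 h4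
  nlinarith

theorem floor_mem_Icc {s a : ℝ} (hs : 0 < s) {K : ℕ} (h : |a| ≤ K * s) :
    ⌊a / s⌋ ∈ Finset.Icc (-K : ℤ) K := by
  rw [abs_le] at h
  rw [Finset.mem_Icc]
  constructor
  · rw [Int.le_floor, le_div_iff₀ hs]; push_cast; linarith
  · have : ((⌊a / s⌋ : ℤ) : ℝ) ≤ ((K : ℤ) : ℝ) :=
      (Int.floor_le _).trans (by rw [div_le_iff₀ hs]; push_cast; linarith)
    exact_mod_cast this

/-- The cells meeting a disc of radius `K` times the side of a cell. -/
noncomputable def gridSquare (K : ℕ) : Finset (ℤ × ℤ) :=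
  Finset.Icc (-K : ℤ) K ×ˢ Finset.Icc (-K : ℤ) K

theorem card_gridSquare (K : ℕ) : (gridSquare K).card = (2 * K + 1) ^ 2 := by
  rw [gridSquare, Finset.card_product, Int.card_Icc, pow_two,
    show ((K : ℤ) + 1 - -K).toNat = 2 * K + 1 by omega]

theorem gridCell_mem {r : ℝ} (hr : 0 < r) {K : ℕ} {z : ℂ} (h : ‖z‖ ≤ K * (2 * r / 3)) :
    gridCell r z ∈ gridSquare K :=
  Finset.mem_product.2 ⟨floor_mem_Icc (by positivity) ((Complex.abs_re_le_norm z).trans h),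
    floor_mem_Icc (by positivity) ((Complex.abs_im_le_norm z).trans h)⟩

variable {G : Type u} [AddCommGroup G] [Finite G]

theorem AddChar.norm_map_sub_sub_one (χ : AddChar G ℂ) (x y : G) :
    ‖χ (x - y) - 1‖ = ‖χ x - χ y‖ := by
  have h : χ (x - y) - 1 = (χ x - χ y) * χ (-y) := by
    rw [sub_eq_add_neg x y, AddChar.map_add_eq_mul, sub_mul, ← AddChar.map_add_eq_mul χ y (-y),
      add_neg_cancel, AddChar.map_zero_eq_one]
  rw [h, norm_mul, AddChar.norm_apply, mul_one]

theorem AddChar.norm_map_neg_sub_one (χ : AddChar G ℂ) (x : G) :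
    ‖χ (-x) - 1‖ = ‖χ x - 1‖ := by
  have := AddChar.norm_map_sub_sub_one χ 0 x
  rwa [zero_sub, AddChar.map_zero_eq_one, norm_sub_rev 1] at this

theorem AddChar.norm_map_add_sub_one (χ : AddChar G ℂ) (x y : G) :
    ‖χ (x + y) - 1‖ ≤ ‖χ x - 1‖ + ‖χ y - 1‖ := by
  have h : χ (x + y) - 1 = (χ x - 1) * χ y + (χ y - 1) := by
    rw [AddChar.map_add_eq_mul]; ring
  rw [h]
  refine (norm_add_le _ _).trans ?_
  rw [norm_mul, AddChar.norm_apply, mul_one]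

open Classical in
/-- The intersection of a dilated family with the Bohr sets of the frequencies `Λ`. -/
noncomputable def bohrInter (C : ℝ → Finset G) (σ : ℝ) (Λ : Finset (AddChar G ℂ)) :
    ℝ → Finset G :=
  fun r => (C (σ * r)).filter fun x => ∀ χ ∈ Λ, ‖χ x - 1‖ ≤ r / 8

theorem mem_bohrInter {C : ℝ → Finset G} {σ r : ℝ} {Λ : Finset (AddChar G ℂ)} {x : G} :
    x ∈ bohrInter C σ Λ r ↔ x ∈ C (σ * r) ∧ ∀ χ ∈ Λ, ‖χ x - 1‖ ≤ r / 8 := by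
  classical
  rw [bohrInter, Finset.mem_filter]

variable {D : ℝ} {C : ℝ → Finset G}

/-- Refine the cells by the grid square of `χ x - 1` for each frequency. The disc of radius `2r/8`
has radius three sides, so `7² ≤ 2⁶` squares suffice: each frequency costs 6 dimensions. -/
theorem CellSystem.inter_bohr (hC : CellSystem D C) {σ : ℝ} (h0 : 0 < σ) (h1 : σ ≤ 1)
    (Λ : Finset (AddChar G ℂ)) : CellSystem (D + 6 * Λ.card) (bohrInter C σ Λ) := by
  have hC' := hC.dilate h0 h1
  refine ⟨fun hs hsr hr x hx => ?_, fun h h' => ?_, fun h h' hx => ?_, fun h h' hrs hx hy => ?_,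
    fun {r} h h' => ?_⟩
  · rw [mem_bohrInter] at hx ⊢
    exact ⟨hC'.mono hs hsr hr hx.1, fun χ hχ => (hx.2 χ hχ).trans (by linarith)⟩
  · rw [mem_bohrInter]
    exact ⟨hC'.zero_mem h h', fun χ _ => by simp; positivity⟩
  · rw [mem_bohrInter] at hx ⊢
    exact ⟨hC'.neg_mem h h' hx.1, fun χ hχ => by
      rw [AddChar.norm_map_neg_sub_one]; exact hx.2 χ hχ⟩
  · rw [mem_bohrInter] at hx hy ⊢
    exact ⟨hC'.add_mem h h' hrs hx.1 hy.1, fun χ hχ =>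
      (AddChar.norm_map_add_sub_one χ _ _).trans (by linarith [hx.2 χ hχ, hy.2 χ hχ])⟩
  · classical
    obtain ⟨ι, T, φ, hT, hφ, h2⟩ := hC'.cells h h'
    refine ⟨ι × (Λ → ℤ × ℤ), T ×ˢ Fintype.piFinset fun _ =>
      gridSquare 3,
      fun x => (φ x, fun χ => gridCell (r / 8) (χ.1 x - 1)), ?_, fun x hx => ?_,
      fun x hx y hy hxy => ?_⟩
    · rw [Finset.card_product, Fintype.card_piFinset]
      simp only [card_gridSquare, Finset.prod_const, Finset.card_univ,
        Fintype.card_coe]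
      norm_num
      rw [Real.rpow_add two_pos]
      gcongr
      rw [Real.rpow_mul two_pos.le, Real.rpow_natCast]
      gcongr
      norm_num
    · rw [mem_bohrInter] at hx
      refine Finset.mem_product.2 ⟨hφ _ hx.1, Fintype.mem_piFinset.2 fun χ =>
        gridCell_mem (K := 3) (by positivity) ((hx.2 χ.1 χ.2).trans (le_of_eq ?_))⟩
      push_cast
      ring
    · rw [mem_bohrInter] at hx hy ⊢
      obtain ⟨hxy1, hxy2⟩ := Prod.ext_iff.1 hxy
      refine ⟨h2 _ hx.1 _ hy.1 hxy1, fun χ hχ => ?_⟩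
      rw [AddChar.norm_map_sub_sub_one]
      have := norm_sub_le_of_gridCell_eq (by positivity) (congrFun hxy2 ⟨χ, hχ⟩)
      simpa using this

/-- Pigeonhole on the values of the frequencies: the disc of radius 2 has radius 48 squares of side
`1/24`, and `97² ≤ 2¹⁴`. Differences within a cell lie in the Bohr set of radius `1/16`. -/
theorem CellSystem.card_le_card_bohrInter (hC : CellSystem D C) {σ : ℝ} (h0 : 0 < σ)
    (h1 : σ ≤ 1) (Λ : Finset (AddChar G ℂ)) :
    ((C (σ / 4)).card : ℝ) ≤ (2 : ℝ) ^ (14 * Λ.card) * (bohrInter C σ Λ (1 / 2)).card := by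
  classical
  obtain ⟨K, hK⟩ : ∃ K : ℕ, K = 48 := ⟨_, rfl⟩
  have key : ∀ z : ℂ, ‖z‖ ≤ 2 → gridCell (1 / 16) z ∈ gridSquare K := fun z hz => by
    have h0 : (0 : ℝ) < 1 / 16 := by norm_num
    have h1 : ‖z‖ ≤ (K : ℝ) * (2 * (1 / 16) / 3) := by
      rw [hK]
      norm_num
      exact hz
    exact gridCell_mem h0 h1
  have := card_le_card_mul_card_of_cells (C (σ / 4)) (bohrInter C σ Λ (1 / 2))
    (Fintype.piFinset fun _ : Λ =>
      gridSquare K)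
    (fun x χ => gridCell (1 / 16) (χ.1 x - 1))
    ?_
    (fun x hx y hy hxy => ?_)
  · refine (Nat.cast_le.2 this).trans ?_
    rw [Nat.cast_mul]
    refine mul_le_mul_of_nonneg_right ?_ (Nat.cast_nonneg _)
    rw [Fintype.card_piFinset]
    simp only [card_gridSquare, Finset.prod_const, Finset.card_univ,
        Fintype.card_coe]
    have h2 : ((2 * K + 1) ^ 2) ≤ 2 ^ 14 := by rw [hK]; norm_num
    rw [pow_mul]
    exact_mod_cast Nat.pow_le_pow_left h2 Λ.card
  · intro x _
    rw [Fintype.mem_piFinset]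
    intro χ
    refine key _ ((norm_sub_le _ _).trans ?_)
    rw [AddChar.norm_apply, norm_one]
    norm_num
  · rw [mem_bohrInter]
    constructor
    · rw [sub_eq_add_neg]
      exact hC.add_mem_of_le (by positivity) (by positivity) (by linarith) (by linarith) hx
        (hC.neg_mem (by positivity) (by linarith) hy)
    · intro χ hχ
      rw [AddChar.norm_map_sub_sub_one]
      have := norm_sub_le_of_gridCell_eq (by norm_num) (congrFun hxy ⟨χ, hχ⟩)
      rw [sub_sub_sub_cancel_right] at this
      exact this.trans (by norm_num)

end Bohr

/-! ### Fourier identities and large spectra -/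

section Fourier

variable {G : Type*} [AddCommGroup G] [Fintype G]

/-- The (unnormalised) Fourier transform of `f` at the character `χ`. -/
noncomputable def charSum (f : G → ℂ) (χ : AddChar G ℂ) : ℂ := ∑ x, f x * χ x

theorem AddChar.mul_conj_apply (χ : AddChar G ℂ) (x y : G) :
    χ x * conj (χ y) = χ (x - y) := by
  rw [← AddChar.map_neg_eq_conj, ← AddChar.map_add_eq_mul, sub_eq_add_neg]

theorem sum_charSum_sq_mul_conj (f g : G → ℂ) :
    ∑ χ, charSum f χ ^ 2 * conj (charSum g χ) =
      Fintype.card G * ∑ x, ∑ y, f x * f y * conj (g (x + y)) := by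
  classical
  have h : ∀ χ : AddChar G ℂ, charSum f χ ^ 2 * conj (charSum g χ) =
      ∑ x, ∑ y, ∑ z, f x * f y * conj (g z) * χ (x + y - z) := fun χ => by
    simp only [charSum, pow_two, map_sum, Finset.sum_mul_sum]
    refine Finset.sum_congr rfl fun x _ => ?_
    simp only [Finset.sum_mul]
    rw [Finset.sum_comm]
    refine Finset.sum_congr rfl fun y _ => Finset.sum_congr rfl fun z _ => ?_
    rw [← AddChar.mul_conj_apply, AddChar.map_add_eq_mul, map_mul]
    ring
  simp only [h]
  rw [Finset.sum_comm, Finset.mul_sum]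
  refine Finset.sum_congr rfl fun x _ => ?_
  rw [Finset.sum_comm, Finset.mul_sum]
  refine Finset.sum_congr rfl fun y _ => ?_
  rw [Finset.sum_comm]
  simp only [← Finset.mul_sum, AddChar.sum_apply_eq_ite, sub_eq_zero]
  simp
  ring

theorem sum_charSum_mul_conj (f g : G → ℂ) :
    ∑ χ, charSum f χ * conj (charSum g χ) = Fintype.card G * ∑ x, f x * conj (g x) := by
  classical
  have h : ∀ χ : AddChar G ℂ, charSum f χ * conj (charSum g χ) =
      ∑ x, ∑ z, f x * conj (g z) * χ (x - z) := fun χ => by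
    simp only [charSum, map_sum, Finset.sum_mul_sum]
    refine Finset.sum_congr rfl fun x _ => Finset.sum_congr rfl fun z _ => ?_
    rw [← AddChar.mul_conj_apply, map_mul]
    ring
  simp only [h]
  rw [Finset.sum_comm, Finset.mul_sum]
  refine Finset.sum_congr rfl fun x _ => ?_
  rw [Finset.sum_comm]
  simp only [← Finset.mul_sum, AddChar.sum_apply_eq_ite, sub_eq_zero]
  simp
  ring

/-- Parseval's identity for real functions. -/
theorem sum_norm_sq_charSum (f : G → ℝ) :
    ∑ χ, ‖charSum (fun x => (f x : ℂ)) χ‖ ^ 2 = Fintype.card G * ∑ x, f x ^ 2 := by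
  have h := sum_charSum_mul_conj (fun x => (f x : ℂ)) (fun x => (f x : ℂ))
  simp only [Complex.mul_conj, Complex.conj_ofReal, ← pow_two] at h
  simp only [Complex.sq_norm]
  exact_mod_cast h

/-- The transform of an average of translates. -/
theorem charSum_average (f : G → ℂ) (V : Finset G) (χ : AddChar G ℂ) :
    charSum (fun y => (V.card : ℂ)⁻¹ * ∑ v ∈ V, f (y + v)) χ =
      charSum f χ * ((V.card : ℂ)⁻¹ * ∑ v ∈ V, χ (-v)) := by
  have h : ∀ v, ∑ y, f (y + v) * χ y = charSum f χ * χ (-v) := fun v => by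
    rw [charSum, Finset.sum_mul, ← Equiv.sum_comp (Equiv.addRight v) fun y => f y * χ y * χ (-v)]
    refine Finset.sum_congr rfl fun y _ => ?_
    rw [Equiv.coe_addRight, mul_assoc, ← AddChar.map_add_eq_mul, add_neg_cancel_right]
  calc charSum (fun y => (V.card : ℂ)⁻¹ * ∑ v ∈ V, f (y + v)) χ
      = (V.card : ℂ)⁻¹ * ∑ v ∈ V, ∑ y, f (y + v) * χ y := by
        rw [charSum, Finset.sum_comm, Finset.mul_sum]
        exact Finset.sum_congr rfl fun y _ => by rw [mul_assoc, Finset.sum_mul]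
    _ = _ := by
        simp only [h]
        rw [← Finset.mul_sum]
        ring

theorem one_sub_le_norm_average {V : Finset G} (hV : V.Nonempty) {χ : AddChar G ℂ} {ε : ℝ}
    (h : ∀ v ∈ V, ‖χ v - 1‖ ≤ ε) :
    1 - ε ≤ ‖(V.card : ℂ)⁻¹ * ∑ v ∈ V, χ (-v)‖ := by
  have hc : (0 : ℝ) < V.card := Nat.cast_pos.2 hV.card_pos
  have hc' : (V.card : ℂ) ≠ 0 := by exact_mod_cast hc.ne'
  have h1 : ‖(V.card : ℂ)⁻¹ * ∑ v ∈ V, χ (-v) - 1‖ ≤ ε := by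
    have h2 : (V.card : ℂ)⁻¹ * ∑ v ∈ V, χ (-v) - 1 =
        (V.card : ℂ)⁻¹ * ∑ v ∈ V, (χ (-v) - 1) := by
      rw [Finset.sum_sub_distrib, mul_sub]
      simp [hc']
    rw [h2, norm_mul, norm_inv, Complex.norm_natCast, inv_mul_le_iff₀ hc]
    refine (norm_sum_le _ _).trans ((Finset.sum_le_card_nsmul _ _ ε fun v hv => ?_).trans ?_)
    · rw [AddChar.norm_map_neg_sub_one]; exact h v hv
    · rw [nsmul_eq_mul]
  have := norm_sub_norm_le (1 : ℂ) ((V.card : ℂ)⁻¹ * ∑ v ∈ V, χ (-v))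
  rw [norm_one, norm_sub_rev] at this
  linarith

/-- If `C` is nearly invariant under translation by `x`, then a character with a large sum over
`C` is close to `1` at `x`. -/
theorem norm_map_sub_one_le_of_large_sum {C C' : Finset G} (hCC : C' ⊆ C) {x : G}
    (hx : ∀ c ∈ C', x + c ∈ C) {ε M : ℝ} (hM : 0 ≤ M) (hε : (1 - ε) * C.card ≤ C'.card)
    {χ : AddChar G ℂ} (hχ : (C.card : ℝ) ≤ M * ‖∑ c ∈ C, χ c‖) (hC : C.Nonempty) :
    ‖χ x - 1‖ ≤ 4 * ε * M := by
  classical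
  have hc : (0 : ℝ) < C.card := Nat.cast_pos.2 hC.card_pos
  have key : ∀ C'' : Finset G, C'' ⊆ C → C''.card = C'.card →
      ‖∑ c ∈ C, χ c - ∑ c ∈ C'', χ c‖ ≤ ε * C.card := fun C'' h h' => by
    rw [← Finset.sum_sdiff h, add_sub_cancel_right]
    refine (norm_sum_le _ _).trans ?_
    simp only [AddChar.norm_apply, Finset.sum_const, nsmul_eq_mul, mul_one]
    rw [Finset.card_sdiff_of_subset h, Nat.cast_sub (Finset.card_le_card h), h']
    linarith
  have h1 := key C' hCC rfl
  have h2 := key (C'.image fun c => x + c)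
    (fun y hy => by obtain ⟨c, hc, rfl⟩ := Finset.mem_image.1 hy; exact hx c hc)
    (Finset.card_image_of_injective _ (add_right_injective x))
  rw [Finset.sum_image fun a _ b _ hab => add_right_injective x hab] at h2
  simp only [AddChar.map_add_eq_mul, ← Finset.mul_sum] at h2
  -- `C'` and `x + C'` are subsets of `C` of equal size, so each bracket is a sum over at most
  -- `ε|C|` missing points.
  have h3 : (χ x - 1) * ∑ c ∈ C, χ c = χ x * (∑ c ∈ C, χ c - ∑ c ∈ C', χ c) -
      (∑ c ∈ C, χ c - χ x * ∑ c ∈ C', χ c) := by ring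
  have h4 : ‖χ x - 1‖ * ‖∑ c ∈ C, χ c‖ ≤ 2 * ε * C.card := by
    rw [← norm_mul, h3]
    refine (norm_sub_le _ _).trans ?_
    rw [norm_mul, AddChar.norm_apply, one_mul]
    linarith
  have h5 : ‖χ x - 1‖ * C.card ≤ (2 * ε * M) * C.card := by
    calc ‖χ x - 1‖ * C.card ≤ ‖χ x - 1‖ * (M * ‖∑ c ∈ C, χ c‖) := by gcongr
      _ = M * (‖χ x - 1‖ * ‖∑ c ∈ C, χ c‖) := by ring
      _ ≤ M * (2 * ε * C.card) := by gcongr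
      _ = _ := by ring
  have h6 := le_of_mul_le_mul_right h5 hc
  have h7 := norm_nonneg (χ x - 1)
  linarith

/-- A local Bessel inequality for almost orthogonal characters on `C`. -/
theorem card_mul_sq_le_of_almost_orthogonal {C A : Finset G} (hAC : A ⊆ C)
    {Λ : Finset (AddChar G ℂ)} {δ M : ℝ} (hδ : 0 ≤ δ) (hM : 0 < M)
    (hΛ : ∀ χ ∈ Λ, δ * A.card ≤ ‖∑ t ∈ A, χ t‖)
    (hsep : ∀ χ ∈ Λ, ∀ ψ ∈ Λ, χ ≠ ψ → M * ‖∑ c ∈ C, (χ - ψ) c‖ ≤ C.card) :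
    Λ.card * δ ^ 2 * A.card ≤ (1 + Λ.card / M) * C.card := by
  classical
  rcases A.eq_empty_or_nonempty with rfl | hA
  · simp; positivity
  rcases Λ.eq_empty_or_nonempty with rfl | hΛ0
  · simp
  have hA0 : (0 : ℝ) < A.card := Nat.cast_pos.2 hA.card_pos
  have hΛ1 : (0 : ℝ) < Λ.card := Nat.cast_pos.2 hΛ0.card_pos
  -- Duality: with these phases the large sums add up to the sum over `A` of one function `F`.
  -- Cauchy–Schwarz passes to the `L²` norm of `F` on `C`, where almost orthogonality controls the
  -- off-diagonal terms.
  have hph : ∀ χ : AddChar G ℂ, ∃ c : ℂ, ‖c‖ = 1 ∧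
      c * ∑ t ∈ A, χ t = (‖∑ t ∈ A, χ t‖ : ℂ) := fun χ => by
    by_cases h0 : ∑ t ∈ A, χ t = 0
    · exact ⟨1, by simp, by simp [h0]⟩
    · refine ⟨‖∑ t ∈ A, χ t‖ / ∑ t ∈ A, χ t, ?_, div_mul_cancel₀ _ h0⟩
      rw [norm_div, Complex.norm_real, norm_norm, div_self (norm_ne_zero_iff.2 h0)]
  choose c hc1 hc2 using hph
  set F : G → ℂ := fun t => ∑ χ ∈ Λ, c χ * χ t with hF
  have h1 : Λ.card * (δ * A.card) ≤ ∑ t ∈ A, ‖F t‖ := by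
    calc Λ.card * (δ * A.card) = ∑ χ ∈ Λ, δ * A.card := by simp
      _ ≤ ∑ χ ∈ Λ, ‖∑ t ∈ A, χ t‖ := Finset.sum_le_sum hΛ
      _ = ‖∑ t ∈ A, F t‖ := by
        rw [hF, Finset.sum_comm]
        simp only [← Finset.mul_sum, hc2]
        rw [← Complex.ofReal_sum, Complex.norm_real, Real.norm_eq_abs,
          abs_of_nonneg (Finset.sum_nonneg fun _ _ => norm_nonneg _)]
      _ ≤ _ := norm_sum_le _ _
  have h2 : (∑ t ∈ A, ‖F t‖) ^ 2 ≤ A.card * ∑ t ∈ C, ‖F t‖ ^ 2 := by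
    refine (sq_sum_le_card_mul_sum_sq).trans ?_
    gcongr
  have h3 : ((∑ t ∈ C, ‖F t‖ ^ 2 : ℝ) : ℂ) =
      ∑ χ ∈ Λ, ∑ ψ ∈ Λ, c χ * conj (c ψ) * ∑ t ∈ C, (χ - ψ) t := by
    push_cast
    simp only [← Complex.mul_conj', hF, map_sum, Finset.sum_mul_sum]
    rw [Finset.sum_comm]
    refine Finset.sum_congr rfl fun χ _ => ?_
    rw [Finset.sum_comm]
    refine Finset.sum_congr rfl fun ψ _ => ?_
    rw [Finset.mul_sum]
    refine Finset.sum_congr rfl fun t _ => ?_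
    rw [AddChar.sub_apply, AddChar.map_neg_eq_conj, map_mul]
    ring
  have h4 : ∑ t ∈ C, ‖F t‖ ^ 2 ≤ Λ.card * ((1 + Λ.card / M) * C.card) := by
    have h5 : ∑ t ∈ C, ‖F t‖ ^ 2 ≤ ∑ χ ∈ Λ, ∑ ψ ∈ Λ, ‖∑ t ∈ C, (χ - ψ) t‖ := by
      have : ‖((∑ t ∈ C, ‖F t‖ ^ 2 : ℝ) : ℂ)‖ = ∑ t ∈ C, ‖F t‖ ^ 2 := by
        rw [Complex.norm_real, Real.norm_eq_abs, abs_of_nonneg (by positivity)]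
      rw [← this, h3]
      refine (norm_sum_le _ _).trans (Finset.sum_le_sum fun χ _ => ?_)
      refine (norm_sum_le _ _).trans (Finset.sum_le_sum fun ψ _ => ?_)
      rw [norm_mul, norm_mul, Complex.norm_conj, hc1, hc1, one_mul, one_mul]
    refine h5.trans ?_
    rw [← nsmul_eq_mul]
    refine Finset.sum_le_card_nsmul _ _ _ fun χ hχ => ?_
    rw [← Finset.add_sum_erase _ _ hχ]
    have h6 : ‖∑ t ∈ C, (χ - χ) t‖ ≤ C.card := by simp
    have h7 : ∑ ψ ∈ Λ.erase χ, ‖∑ t ∈ C, (χ - ψ) t‖ ≤ Λ.card * (C.card / M) := by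
      refine (Finset.sum_le_card_nsmul _ _ (C.card / M) fun ψ hψ => ?_).trans ?_
      · rw [le_div_iff₀' hM]
        exact hsep χ hχ ψ (Finset.mem_of_mem_erase hψ) (Finset.ne_of_mem_erase hψ).symm
      · rw [nsmul_eq_mul]
        gcongr
        exact Finset.erase_subset _ _
    calc _ ≤ (C.card : ℝ) + Λ.card * (C.card / M) := add_le_add h6 h7
      _ = _ := by ring
  have h8 : (Λ.card * (δ * A.card)) ^ 2 ≤
      A.card * (Λ.card * ((1 + Λ.card / M) * C.card)) :=
    ((pow_le_pow_left₀ (by positivity) h1 2).trans h2).trans (by gcongr)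
  refine le_of_mul_le_mul_left (a := (A.card * Λ.card : ℝ)) ?_ (by positivity)
  linarith

/-- A large spectrum is covered by few translates of the large spectrum of `C`. -/
theorem exists_spectrum_cover {C A : Finset G} (hAC : A ⊆ C) (hC : C.Nonempty)
    {S : Finset (AddChar G ℂ)} {δ M : ℝ} (hδ : 0 ≤ δ) (hM : 0 < M)
    (hS : ∀ χ ∈ S, δ * A.card ≤ ‖∑ t ∈ A, χ t‖) (hMδ : 2 * C.card < M * δ ^ 2 * A.card) :
    ∃ Λ : Finset (AddChar G ℂ), (Λ.card : ℝ) ≤ M ∧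
      ∀ χ ∈ S, ∃ ψ ∈ Λ, (C.card : ℝ) ≤ M * ‖∑ c ∈ C, (χ - ψ) c‖ := by
  classical
  have hc : (0 : ℝ) < C.card := Nat.cast_pos.2 hC.card_pos
  -- A maximal almost orthogonal subset of `S` serves as the set of centres; the Bessel inequality
  -- bounds its size.
  let P := S.powerset.filter fun Λ => ∀ χ ∈ Λ, ∀ ψ ∈ Λ, χ ≠ ψ →
    M * ‖∑ c ∈ C, (χ - ψ) c‖ ≤ C.card
  obtain ⟨Λ, hΛ, hmax⟩ := P.exists_max_image Finset.card ⟨∅, by simp [P]⟩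
  obtain ⟨hΛS, hsep⟩ := Finset.mem_filter.1 hΛ
  rw [Finset.mem_powerset] at hΛS
  refine ⟨Λ, ?_, fun χ hχ => ?_⟩
  · have h := card_mul_sq_le_of_almost_orthogonal hAC hδ hM (fun χ hχ => hS χ (hΛS hχ)) hsep
    by_contra! hlt
    have h1 : 2 * C.card * (Λ.card : ℝ) < M * ((1 + Λ.card / M) * C.card) := by
      calc 2 * C.card * (Λ.card : ℝ) < M * δ ^ 2 * A.card * Λ.card := by
            gcongr; exact hM.trans hlt
        _ = M * (Λ.card * δ ^ 2 * A.card) := by ring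
        _ ≤ _ := by gcongr
    have h2 : M * ((1 + Λ.card / M) * C.card) = (M + Λ.card) * C.card := by
      field_simp
    rw [h2] at h1
    nlinarith
  · by_contra! hno
    by_cases hmem : χ ∈ Λ
    · have := hno χ hmem
      -- A centre covers itself as soon as `M ≥ 1`; Bessel for the single character `χ`, with `hMδ`,
      -- gives this.
      have h3 := card_mul_sq_le_of_almost_orthogonal hAC hδ hM (Λ := {χ})
        (fun ψ hψ => hS ψ (by rw [Finset.mem_singleton.1 hψ]; exact hχ))
        (fun a ha b hb hab => absurd ((Finset.mem_singleton.1 ha).trans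
          (Finset.mem_singleton.1 hb).symm) hab)
      simp at this h3
      have h4 : M * (δ ^ 2 * A.card) ≤ M * ((1 + M⁻¹) * C.card) := by gcongr
      have h5 : M * ((1 + M⁻¹) * C.card) = (M + 1) * C.card := by field_simp
      rw [h5] at h4
      nlinarith
    · have hins : insert χ Λ ∈ P := by
        refine Finset.mem_filter.2 ⟨Finset.mem_powerset.2 (Finset.insert_subset hχ hΛS), ?_⟩
        have hsymm : ∀ ψ ∈ Λ, M * ‖∑ c ∈ C, (ψ - χ) c‖ ≤ C.card := fun ψ hψ => by
          have : ‖∑ c ∈ C, (ψ - χ) c‖ = ‖∑ c ∈ C, (χ - ψ) c‖ := by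
            rw [← Complex.norm_conj, map_sum]
            congr 1
            refine Finset.sum_congr rfl fun t _ => ?_
            rw [← AddChar.map_neg_eq_conj, ← AddChar.neg_apply, neg_sub]
          rw [this]
          exact (hno ψ hψ).le
        intro a ha b hb hab
        rcases Finset.mem_insert.1 ha with rfl | ha' <;>
          rcases Finset.mem_insert.1 hb with rfl | hb'
        · exact absurd rfl hab
        · exact (hno b hb').le
        · exact hsymm a ha'
        · exact hsep a ha' b hb' hab
      have := hmax _ hins
      rw [Finset.card_insert_of_notMem hmem] at this
      omega

end Fourier

/-! ### From Fourier mass to a density increment -/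

section Increment

variable {G : Type*}

theorem indicatorFun_apply [DecidableEq G] (A : Finset G) (x : G) :
    indicatorFun A x = if x ∈ A then 1 else 0 := by
  simp [indicatorFun, Set.indicator_apply]

theorem indicatorFun_nonneg (A : Finset G) (x : G) : 0 ≤ indicatorFun A x := by
  classical
  rw [indicatorFun_apply]; split_ifs <;> norm_num

section

variable [Fintype G]

theorem sum_indicatorFun_mul (A : Finset G) (h : G → ℝ) :
    ∑ x, indicatorFun A x * h x = ∑ x ∈ A, h x := by
  classical
  simp [indicatorFun_apply]

theorem sum_indicatorFun (A : Finset G) : ∑ x, indicatorFun A x = A.card := by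
  simpa using sum_indicatorFun_mul A 1

/-- The indicator function of `A` minus its mean on `R`, as a function supported on `R`. -/
noncomputable def balanced (A R : Finset G) (x : G) : ℝ :=
  indicatorFun A x - (A.card / R.card : ℝ) * indicatorFun R x

theorem sum_balanced_sq_le {A R : Finset G} (h : A ⊆ R) :
    ∑ x, balanced A R x ^ 2 ≤ A.card := by
  classical
  have h1 : ∀ x, balanced A R x ^ 2 = indicatorFun A x * (1 - 2 * (A.card / R.card : ℝ)) +
      indicatorFun R x * (A.card / R.card : ℝ) ^ 2 := fun x => by
    simp only [balanced, indicatorFun_apply]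
    by_cases hA : x ∈ A
    · simp [hA, h hA]; ring
    · by_cases hR : x ∈ R <;> simp [hA, hR]
  simp only [h1, Finset.sum_add_distrib, ← Finset.sum_mul, sum_indicatorFun]
  rcases R.eq_empty_or_nonempty with rfl | hR
  · simp
  have hR0 : (0 : ℝ) < R.card := Nat.cast_pos.2 hR.card_pos
  have h2 : (R.card : ℝ) * (A.card / R.card : ℝ) ^ 2 = A.card * (A.card / R.card : ℝ) := by
    field_simp
  have h3 : (0 : ℝ) ≤ A.card * (A.card / R.card : ℝ) := by positivity
  rw [h2]
  linarith

end

variable [AddCommGroup G]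

/-- The part of `S` whose translate by `z` lies in `A`. -/
def slice [DecidableEq G] (A : Finset G) (z : G) (S : Finset G) : Finset G :=
  S.filter fun s => s + z ∈ A

section Slice

variable [DecidableEq G]

theorem slice_subset (A : Finset G) (z : G) (S : Finset G) : slice A z S ⊆ S :=
  Finset.filter_subset _ _

theorem mem_slice {A : Finset G} {z : G} {S : Finset G} {s : G} :
    s ∈ slice A z S ↔ s ∈ S ∧ s + z ∈ A := Finset.mem_filter

theorem slice_mono (A : Finset G) (z : G) {S S' : Finset G} (h : S ⊆ S') :
    slice A z S ⊆ slice A z S' := Finset.filter_subset_filter _ h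

/-- Double counting: for each `s`, the map `u ↦ u - s` injects the slice over `T` into the shifts `z
∈ P` that bring `s` into `A`. -/
theorem card_slice_mul_card_le (A : Finset G) (x : G) {S T P : Finset G}
    (h : ∀ u ∈ T, ∀ s ∈ S, u - s ∈ P) :
    (slice A x T).card * S.card ≤ ∑ z ∈ P, (slice A (x + z) S).card := by
  have h1 : ∑ z ∈ P, (slice A (x + z) S).card =
      ∑ s ∈ S, (P.filter fun z => s + (x + z) ∈ A).card := by
    simp only [slice, Finset.card_filter]
    exact Finset.sum_comm
  rw [h1, mul_comm, ← smul_eq_mul]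
  refine Finset.card_nsmul_le_sum _ _ _ fun s hs => ?_
  refine Finset.card_le_card_of_injOn (fun u => u - s) (fun u hu => ?_)
    fun u _ u' _ huu => by simpa using huu
  obtain ⟨hu1, hu2⟩ := mem_slice.1 (Finset.mem_coe.1 hu)
  refine Finset.mem_coe.2 (Finset.mem_filter.2 ⟨h u hu1 s hs, ?_⟩)
  rwa [show s + (x + (u - s)) = u + x by abel]

end Slice

variable [Fintype G]

/-- If `A' - A ⊆ R`, the number of solutions of `x + y ∈ A'` with `x, y ∈ A` exceeds its expected
value up to the contribution of the balanced function. -/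
theorem balanced_count_le {A R A' : Finset G} (hR : R.Nonempty)
    (hA' : ∀ t ∈ A', ∀ a ∈ A, t - a ∈ R) :
    (A.card / R.card : ℝ) ^ 2 * R.card * A'.card +
        ∑ x, ∑ y, balanced A R x * balanced A R y * indicatorFun A' (x + y) ≤
      ∑ x, ∑ y, indicatorFun A x * indicatorFun A y * indicatorFun A' (x + y) := by
  classical
  have hR0 : (0 : ℝ) < R.card := Nat.cast_pos.2 hR.card_pos
  set α : ℝ := A.card / R.card with hα
  have hαR : α * R.card = A.card := div_mul_cancel₀ _ hR0.ne'
  -- For `x ∈ A`, every `y` with `x + y ∈ A'` lies in `R`. Hence the mixed terms are exact, and only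
  -- the `R`–`R` term needs an inequality.
  have h1 : ∑ x, ∑ y, indicatorFun A x * indicatorFun R y * indicatorFun A' (x + y) =
      A.card * A'.card := by
    simp only [mul_assoc, ← Finset.mul_sum]
    rw [sum_indicatorFun_mul, ← nsmul_eq_mul]
    refine Finset.sum_eq_card_nsmul fun x hx => ?_
    rw [← sum_indicatorFun A', ← Equiv.sum_comp (Equiv.addLeft x) (indicatorFun A')]
    refine Finset.sum_congr rfl fun y _ => ?_
    simp only [Equiv.coe_addLeft, indicatorFun_apply]
    by_cases h : x + y ∈ A'
    · have := hA' _ h x hx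
      rw [add_sub_cancel_left] at this
      simp [h, this]
    · simp [h]
  have h2 : ∑ x, ∑ y, indicatorFun R x * indicatorFun A y * indicatorFun A' (x + y) =
      A.card * A'.card := by
    rw [← h1, Finset.sum_comm]
    refine Finset.sum_congr rfl fun x _ => Finset.sum_congr rfl fun y _ => ?_
    rw [add_comm x y]; ring
  have h3 : ∑ x, ∑ y, indicatorFun R x * indicatorFun R y * indicatorFun A' (x + y) ≤
      R.card * A'.card := by
    simp only [mul_assoc, ← Finset.mul_sum]
    rw [sum_indicatorFun_mul, ← nsmul_eq_mul]
    refine Finset.sum_le_card_nsmul _ _ _ fun x hx => ?_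
    rw [← sum_indicatorFun A', ← Equiv.sum_comp (Equiv.addLeft x) (indicatorFun A')]
    refine Finset.sum_le_sum fun y _ => ?_
    simp only [Equiv.coe_addLeft, indicatorFun_apply]
    split_ifs <;> norm_num
  have h4 : ∑ x, ∑ y, balanced A R x * balanced A R y * indicatorFun A' (x + y) =
      ∑ x, ∑ y, indicatorFun A x * indicatorFun A y * indicatorFun A' (x + y) -
      α * ∑ x, ∑ y, indicatorFun A x * indicatorFun R y * indicatorFun A' (x + y) -
      α * ∑ x, ∑ y, indicatorFun R x * indicatorFun A y * indicatorFun A' (x + y) +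
      α ^ 2 * ∑ x, ∑ y, indicatorFun R x * indicatorFun R y * indicatorFun A' (x + y) := by
    simp only [Finset.mul_sum, ← Finset.sum_sub_distrib, ← Finset.sum_add_distrib, balanced,
      ← hα]
    refine Finset.sum_congr rfl fun x _ => Finset.sum_congr rfl fun y _ => ?_
    ring
  rw [h4, h1, h2, ← hαR]
  have h5 := mul_le_mul_of_nonneg_left h3 (sq_nonneg α)
  nlinarith

theorem charSum_indicatorFun (A : Finset G) (χ : AddChar G ℂ) :
    charSum (fun x => (indicatorFun A x : ℂ)) χ = ∑ x ∈ A, χ x := by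
  classical
  have h : ∀ x, ((indicatorFun A x : ℝ) : ℂ) * χ x = if x ∈ A then χ x else 0 := fun x => by
    rw [indicatorFun_apply]; split_ifs <;> simp
  simp [charSum, h]

/-- Either there are many solutions of `x + y ∈ A'` with `x, y ∈ A`, or the balanced function of
`A` has much energy at the large spectrum of `A'`. -/
theorem many_solutions_or_large_energy {A R A' : Finset G} (hR : R.Nonempty) (hAR : A ⊆ R)
    (hA' : ∀ t ∈ A', ∀ a ∈ A, t - a ∈ R) {S : Finset (AddChar G ℂ)}
    (hS : ∀ χ, χ ∉ S → ‖∑ t ∈ A', χ t‖ ≤ (A.card / R.card : ℝ) / 4 * A'.card) :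
    (A.card / R.card : ℝ) ^ 2 / 4 * R.card * A'.card ≤
        ∑ x, ∑ y, indicatorFun A x * indicatorFun A y * indicatorFun A' (x + y) ∨
      (A.card / R.card : ℝ) ^ 2 / 2 * R.card * Fintype.card G ≤
        ∑ χ ∈ S, ‖charSum (fun x => (balanced A R x : ℂ)) χ‖ ^ 2 := by
  classical
  have hR0 : (0 : ℝ) < R.card := Nat.cast_pos.2 hR.card_pos
  have hcount := balanced_count_le hR hA'
  have hpars := sum_norm_sq_charSum (balanced A R)
  have hsq := sum_balanced_sq_le hAR
  have htri := sum_charSum_sq_mul_conj (fun x => (balanced A R x : ℂ))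
    (fun x => (indicatorFun A' x : ℂ))
  set α : ℝ := A.card / R.card with hα
  have hα0 : 0 ≤ α := by positivity
  have hαR : α * R.card = A.card := div_mul_cancel₀ _ hR0.ne'
  set E : AddChar G ℂ → ℝ := fun χ => ‖charSum (fun x => (balanced A R x : ℂ)) χ‖ ^ 2 with hE
  set Γ : ℝ := ∑ x, ∑ y, balanced A R x * balanced A R y * indicatorFun A' (x + y) with hΓ
  by_contra! hcon
  obtain ⟨hc1, hc2⟩ := hcon
  have hA'0 : (0 : ℝ) < A'.card := by
    rcases A'.eq_empty_or_nonempty with rfl | h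
    · exfalso
      simp [indicatorFun_apply] at hc1
    · exact Nat.cast_pos.2 h.card_pos
  have hG0 : (0 : ℝ) < Fintype.card G := Nat.cast_pos.2 (Fintype.card_pos_iff.2 ⟨0⟩)
  have h1 : (3 / 4) * α ^ 2 * R.card * A'.card < |Γ| := by
    have := neg_le_abs Γ
    linarith
  have h2 : Fintype.card G * |Γ| ≤ ∑ χ, E χ * ‖∑ t ∈ A', χ t‖ := by
    have h3 : (Fintype.card G * ∑ x, ∑ y, (balanced A R x : ℂ) * (balanced A R y : ℂ) *
        conj (indicatorFun A' (x + y) : ℂ)) = ((Fintype.card G * Γ : ℝ) : ℂ) := by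
      rw [hΓ]; push_cast; simp only [Complex.conj_ofReal]
    rw [h3] at htri
    have h4 : Fintype.card G * |Γ| = ‖((Fintype.card G * Γ : ℝ) : ℂ)‖ := by
      rw [Complex.norm_real, Real.norm_eq_abs, abs_mul, abs_of_pos hG0]
    rw [h4, ← htri]
    refine (norm_sum_le _ _).trans (Finset.sum_le_sum fun χ _ => ?_)
    rw [norm_mul, norm_pow, Complex.norm_conj, charSum_indicatorFun]
  -- By Parseval the characters outside `S` account for at most `α²/4` of the `3α²/4` required,
  -- which leaves `α²/2` for `S`.
  have h5 : ∑ χ, E χ * ‖∑ t ∈ A', χ t‖ ≤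
      (∑ χ ∈ S, E χ) * A'.card + (∑ χ, E χ) * (α / 4 * A'.card) := by
    rw [Finset.sum_mul, Finset.sum_mul, ← Finset.sum_add_sum_compl S]
    refine add_le_add (Finset.sum_le_sum fun χ _ => ?_) ?_
    · refine mul_le_mul_of_nonneg_left ?_ (sq_nonneg _)
      refine (norm_sum_le _ _).trans (by simp)
    · refine (Finset.sum_le_sum fun χ hχ => ?_).trans
        (Finset.sum_le_sum_of_subset_of_nonneg (Finset.subset_univ _) fun χ _ _ => by positivity)
      exact mul_le_mul_of_nonneg_left (hS χ (Finset.mem_compl.1 hχ)) (sq_nonneg _)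
  have h6 : (∑ χ, E χ) * (α / 4 * A'.card) ≤
      (Fintype.card G * (α * R.card)) * (α / 4 * A'.card) := by
    rw [hpars, hαR]
    gcongr
  have h7 : (∑ χ ∈ S, E χ) * A'.card < (α ^ 2 / 2 * R.card * Fintype.card G) * A'.card := by
    gcongr
  have h8 : Fintype.card G * ((3 / 4) * α ^ 2 * R.card * A'.card) < Fintype.card G * |Γ| := by
    gcongr
  linarith

/-- Energy at characters which are nearly trivial on `V` gives a density increment on a translate
of `V`. -/
theorem exists_increment_of_large_energy [DecidableEq G] {A R V : Finset G} (hR : R.Nonempty)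
    (hA : A.Nonempty) (hV : V.Nonempty) (hVR : ∀ a ∈ A, ∀ v ∈ V, ∀ v' ∈ V, a - v + v' ∈ R)
    {S : Finset (AddChar G ℂ)} (hS : ∀ χ ∈ S, ∀ v ∈ V, ‖χ v - 1‖ ≤ 1 / 4)
    (hE : (A.card / R.card : ℝ) ^ 2 / 2 * R.card * Fintype.card G ≤
        ∑ χ ∈ S, ‖charSum (fun x => (balanced A R x : ℂ)) χ‖ ^ 2) :
    ∃ z, 5 / 4 * (A.card / R.card : ℝ) * V.card ≤ (slice A z V).card := by
  have hR0 : (0 : ℝ) < R.card := Nat.cast_pos.2 hR.card_pos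
  have hA0 : (0 : ℝ) < A.card := Nat.cast_pos.2 hA.card_pos
  have hV0 : (0 : ℝ) < V.card := Nat.cast_pos.2 hV.card_pos
  have hG0 : (0 : ℝ) < Fintype.card G := Nat.cast_pos.2 (Fintype.card_pos_iff.2 ⟨0⟩)
  set α : ℝ := A.card / R.card with hα
  have hα0 : 0 < α := by positivity
  have hαR : α * R.card = A.card := div_mul_cancel₀ _ hR0.ne'
  let av : (G → ℝ) → G → ℝ := fun f y => (V.card : ℝ)⁻¹ * ∑ v ∈ V, f (y + v)
  have hav : ∀ f y, av f y = (V.card : ℝ)⁻¹ * ∑ v ∈ V, f (y + v) := fun _ _ => rfl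
  have havsum : ∀ f, ∑ y, av f y = ∑ y, f y := fun f => by
    simp only [hav, ← Finset.mul_sum]
    rw [Finset.sum_comm]
    have : ∀ v, ∑ y, f (y + v) = ∑ y, f y := fun v => Equiv.sum_comp (Equiv.addRight v) f
    simp only [this]
    rw [Finset.sum_const, nsmul_eq_mul, inv_mul_cancel_left₀ hV0.ne']
  set P := av (indicatorFun A) with hP
  set Q := av (indicatorFun R) with hQ
  have hPsum : ∑ y, P y = A.card := (havsum _).trans (sum_indicatorFun A)
  have hQsum : ∑ y, Q y = R.card := (havsum _).trans (sum_indicatorFun R)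
  have hF : ∀ y, av (balanced A R) y = P y - α * Q y := fun y => by
    simp only [hP, hQ, hav, balanced, ← hα, Finset.sum_sub_distrib, ← Finset.mul_sum]
    ring
  have hPslice : ∀ y, P y = (slice A y V).card / V.card := fun y => by
    simp only [hP, hav, indicatorFun_apply, slice, Finset.card_filter, add_comm y]
    push_cast
    rw [div_eq_inv_mul]
  have hP0 : ∀ y, 0 ≤ P y := fun y => by rw [hPslice]; positivity
  have hQ0 : ∀ y, 0 ≤ Q y := fun y =>
    mul_nonneg (by positivity) (Finset.sum_nonneg fun _ _ => indicatorFun_nonneg _ _)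
  have hQ1 : ∀ y, Q y ≤ 1 := fun y => by
    rw [hQ, hav, inv_mul_le_iff₀ hV0, mul_one]
    refine (Finset.sum_le_card_nsmul _ _ 1 fun v _ => ?_).trans (by simp)
    rw [indicatorFun_apply]; split_ifs <;> norm_num
  -- Where the average `P` of `1_A` is nonzero, the whole translate of `V` lies in `R`, so `Q = 1`
  -- there.
  have hPQ : ∀ y, P y * Q y = P y := fun y => by
    rcases (slice A y V).eq_empty_or_nonempty with h | ⟨v, hv⟩
    · rw [hPslice, h]; simp
    · rw [slice, Finset.mem_filter] at hv
      have : Q y = 1 := by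
        rw [hQ, hav, inv_mul_eq_one₀ hV0.ne']
        have : ∀ v' ∈ V, indicatorFun R (y + v') = 1 := fun v' hv' => by
          have := hVR _ hv.2 v hv.1 v' hv'
          rw [add_sub_cancel_left] at this
          rw [indicatorFun_apply, if_pos this]
        rw [Finset.sum_congr rfl this]
        simp
      rw [this, mul_one]
  have hpars := sum_norm_sq_charSum (av (balanced A R))
  -- Averaging over `V` multiplies the transform on `S` by at least `3/4`, and `1/2 · (3/4)² =
  -- 9/32`.
  have hlow : 9 / 32 * α ^ 2 * R.card * Fintype.card G ≤
      Fintype.card G * ∑ y, av (balanced A R) y ^ 2 := by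
    rw [← hpars]
    have h1 : ∀ χ, charSum (fun y => (av (balanced A R) y : ℂ)) χ =
        charSum (fun x => (balanced A R x : ℂ)) χ * ((V.card : ℂ)⁻¹ * ∑ v ∈ V, χ (-v)) :=
      fun χ => by
        rw [← charSum_average]
        simp only [hav]
        push_cast
        rfl
    calc 9 / 32 * α ^ 2 * R.card * Fintype.card G
        = (α ^ 2 / 2 * R.card * Fintype.card G) * (9 / 16) := by ring
      _ ≤ (∑ χ ∈ S, ‖charSum (fun x => (balanced A R x : ℂ)) χ‖ ^ 2) * (9 / 16) := by gcongr
      _ ≤ ∑ χ ∈ S, ‖charSum (fun y => (av (balanced A R) y : ℂ)) χ‖ ^ 2 := by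
        rw [Finset.sum_mul]
        refine Finset.sum_le_sum fun χ hχ => ?_
        rw [h1, norm_mul, mul_pow]
        refine mul_le_mul_of_nonneg_left ?_ (sq_nonneg _)
        have := one_sub_le_norm_average hV (hS χ hχ)
        nlinarith
      _ ≤ _ := Finset.sum_le_sum_of_subset_of_nonneg (Finset.subset_univ _)
        fun χ _ _ => sq_nonneg _
  have hlow' : 9 / 32 * α ^ 2 * R.card ≤ ∑ y, av (balanced A R) y ^ 2 := by
    refine le_of_mul_le_mul_left ?_ hG0
    linarith
  have hexp : ∑ y, av (balanced A R) y ^ 2 ≤ ∑ y, P y ^ 2 - α * A.card := by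
    have h1 : ∀ y, av (balanced A R) y ^ 2 ≤ P y ^ 2 - 2 * α * P y + α ^ 2 * Q y := fun y => by
      rw [hF]
      have := mul_nonneg (sq_nonneg α) (mul_nonneg (hQ0 y) (sub_nonneg.2 (hQ1 y)))
      nlinarith [hPQ y]
    refine (Finset.sum_le_sum fun y _ => h1 y).trans (le_of_eq ?_)
    rw [Finset.sum_add_distrib, Finset.sum_sub_distrib,
      ← Finset.mul_sum Finset.univ P, ← Finset.mul_sum Finset.univ Q, hPsum, hQsum, ← hαR]
    ring
  by_contra! hcon
  -- If every density is below `5/4 α`, the second moment of `P` is too small, since `1 + 9/32 >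
  -- 5/4`.
  have hup : ∑ y, P y ^ 2 ≤ 5 / 4 * α * A.card := by
    rw [← hPsum, Finset.mul_sum]
    refine Finset.sum_le_sum fun y _ => ?_
    rw [pow_two]
    refine mul_le_mul_of_nonneg_right ?_ (hP0 y)
    rw [hPslice, div_le_iff₀ hV0]
    exact (hcon y).le
  have : 0 < α ^ 2 * R.card := by positivity
  rw [← hαR] at hup hexp
  linarith

end Increment

/-! ### Regular scales -/

section Scale

/-- Otherwise each of the `M` steps from `r / 2` to `r` multiplies `s` by more than `q`, in total by
more than `q ^ M ≥ K`. -/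
theorem exists_regular_of_doubling (s : ℝ → ℝ) {r K q : ℝ} (hq : 0 < q) (hpos : 0 < s (r / 2))
    (M : ℕ) (hM : 0 < M) (hK : K ≤ q ^ M) (hs : s r ≤ K * s (r / 2)) (hr : 0 < r) :
    ∃ ρ, r / 2 ≤ ρ - r / (2 * M) ∧ ρ ≤ r ∧ s ρ ≤ q * s (ρ - r / (2 * M)) := by
  have hM0 : (0 : ℝ) < M := Nat.cast_pos.2 hM
  by_contra! hcon
  have key : ∀ j : ℕ, 0 < j → j ≤ M → q ^ j * s (r / 2) < s (r / 2 + j * (r / (2 * M))) := by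
    intro j hj
    induction j with
    | zero => exact absurd hj (lt_irrefl _)
    | succ j ih =>
      intro hjM
      have hj1 : ((j : ℝ) + 1) * (r / (2 * M)) ≤ r / 2 := by
        have : ((j : ℝ) + 1) ≤ M := by exact_mod_cast hjM
        calc ((j : ℝ) + 1) * (r / (2 * M)) ≤ M * (r / (2 * M)) := by gcongr
          _ = r / 2 := by field_simp
      have h1 := hcon (r / 2 + (j + 1 : ℕ) * (r / (2 * M))) (by
          push_cast
          have : (0 : ℝ) ≤ j * (r / (2 * M)) := by positivity
          linarith) (by push_cast; linarith)
      rw [show r / 2 + ((j + 1 : ℕ) : ℝ) * (r / (2 * M)) - r / (2 * M) =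
        r / 2 + j * (r / (2 * M)) by push_cast; ring] at h1
      refine lt_of_le_of_lt ?_ h1
      rw [pow_succ', mul_assoc]
      refine mul_le_mul_of_nonneg_left ?_ hq.le
      rcases Nat.eq_zero_or_pos j with rfl | hj0
      · simp
      · exact (ih hj0 (by omega)).le
  have h := key M hM le_rfl
  rw [show r / 2 + (M : ℝ) * (r / (2 * M)) = r by field_simp; norm_num] at h
  have := mul_le_mul_of_nonneg_right hK hpos.le
  linarith

/-- The relative width of the scales at which a system is shrunk. -/
noncomputable def scaleWidth (α D : ℝ) : ℝ := α ^ 3 / (2 ^ 15 * D)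

theorem scaleWidth_pos {α D : ℝ} (hα : 0 < α) (hD : 1 ≤ D) : 0 < scaleWidth α D := by
  unfold scaleWidth; positivity

theorem scaleWidth_le {α D : ℝ} (hα : 0 < α) (hα1 : α ≤ 1) (hD : 1 ≤ D) :
    scaleWidth α D ≤ 1 / 2 ^ 15 := by
  unfold scaleWidth
  have : α ^ 3 ≤ 1 := pow_le_one₀ hα.le hα1
  gcongr
  linarith

/-- Two systems have a common regular scale in `[r / 2, r]`. -/
theorem CellSystem.exists_regular_scale {G : Type*} [AddCommGroup G] {α D r : ℝ}
    {B C : ℝ → Finset G} (hB : CellSystem D B) (hC : CellSystem D C) (hα : 0 < α) (hα1 : α ≤ 1)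
    (hD : 1 ≤ D) (hr : 0 < r) (hr1 : r ≤ 1) :
    ∃ ρ, r / 2 ≤ ρ ∧ ρ ≤ r ∧
      (1 - α ^ 3 / 2 ^ 11) * (B ρ).card ≤ ((B (ρ * (1 - 2 * scaleWidth α D))).card : ℝ) ∧
      (1 - α ^ 3 / 2 ^ 11) * (C ρ).card ≤ ((C (ρ * (1 - 2 * scaleWidth α D))).card : ℝ) := by
  set ε : ℝ := α ^ 3 / 2 ^ 11 with hε
  have hε0 : 0 < ε := by positivity
  have hα3 : α ^ 3 ≤ 1 := pow_le_one₀ hα.le hα1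
  have hε1 : ε < 1 := by rw [hε]; linarith
  set M : ℕ := ⌈2 * D / ε⌉₊ with hM
  have hM0 : 0 < M := Nat.ceil_pos.2 (by positivity)
  have hM0' : (0 : ℝ) < M := Nat.cast_pos.2 hM0
  have hM1 : 2 * D / ε ≤ M := Nat.le_ceil _
  have hM2 : (M : ℝ) ≤ 2 ^ 13 * D / α ^ 3 := by
    have h1 : (M : ℝ) < 2 * D / ε + 1 := Nat.ceil_lt_add_one (by positivity)
    have h2 : 2 * D / ε = 2 ^ 12 * D / α ^ 3 := by rw [hε]; field_simp
    have h3 : 1 ≤ 2 ^ 12 * D / α ^ 3 := by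
      rw [le_div_iff₀ (by positivity)]; linarith
    rw [h2] at h1
    have h4 : (2 : ℝ) ^ 13 * D / α ^ 3 = 2 * (2 ^ 12 * D / α ^ 3) := by ring
    linarith
  have hdB := hB.card_double (r := r / 2) (by positivity) (by linarith)
  have hdC := hC.card_double (r := r / 2) (by positivity) (by linarith)
  rw [show 2 * (r / 2) = r by ring] at hdB hdC
  have hposB := hB.card_pos (r := r / 2) (by positivity) (by linarith)
  have hposC := hC.card_pos (r := r / 2) (by positivity) (by linarith)
  -- Pigeonholing the product of the two sizes treats both systems at once: each size is monotone,
  -- so a bound on the product of the ratios bounds each ratio.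
  obtain ⟨ρ, h1, h2, h3⟩ := exists_regular_of_doubling
    (fun ρ => ((B ρ).card : ℝ) * (C ρ).card) (r := r) (K := (2 : ℝ) ^ (2 * D))
    (q := (2 : ℝ) ^ ε) (by positivity) (by positivity) M hM0 (by
      rw [← Real.rpow_natCast, ← Real.rpow_mul two_pos.le]
      refine Real.rpow_le_rpow_of_exponent_le one_le_two ?_
      rwa [div_le_iff₀' hε0] at hM1) (by
      rw [two_mul, Real.rpow_add two_pos]
      calc ((B r).card : ℝ) * (C r).card
          ≤ ((2 : ℝ) ^ D * (B (r / 2)).card) * ((2 : ℝ) ^ D * (C (r / 2)).card) := by gcongr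
        _ = _ := by ring) hr
  have hw : ρ * (2 * scaleWidth α D) ≤ r / (2 * M) := by
    have hw0 := scaleWidth_pos hα hD
    calc ρ * (2 * scaleWidth α D) ≤ r * (2 * scaleWidth α D) := by gcongr
      _ = r / (2 ^ 14 * D / α ^ 3) := by unfold scaleWidth; field_simp
      _ ≤ r / (2 * M) := by
        gcongr
        have : (2 : ℝ) ^ 14 * D / α ^ 3 = 2 * (2 ^ 13 * D / α ^ 3) := by ring
        linarith
  have hr2 : 0 < r / (2 * M) := by positivity
  have hρ0 : 0 < ρ - r / (2 * M) := by linarith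
  have hw1 : ρ - r / (2 * M) ≤ ρ * (1 - 2 * scaleWidth α D) := by linarith
  have hw2 : ρ * (1 - 2 * scaleWidth α D) ≤ ρ := by
    have := scaleWidth_pos hα hD
    nlinarith
  have hq : (1 - ε) * (2 : ℝ) ^ ε ≤ 1 := by
    have h4 : 1 - ε ≤ (2 : ℝ) ^ (-ε) := by
      rw [Real.rpow_def_of_pos two_pos]
      have h5 := Real.add_one_le_exp (Real.log 2 * -ε)
      have h6 : Real.log 2 ≤ 1 := by linarith [Real.log_two_lt_d9]
      nlinarith
    calc (1 - ε) * (2 : ℝ) ^ ε ≤ (2 : ℝ) ^ (-ε) * (2 : ℝ) ^ ε := by gcongr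
      _ = 1 := by rw [← Real.rpow_add two_pos]; simp
  have hBm := hB.card_mono hρ0 (by linarith) (h2.trans hr1)
  have hCm := hC.card_mono hρ0 (by linarith) (h2.trans hr1)
  have hBm' := hB.card_mono hρ0 hw1 (hw2.trans (h2.trans hr1))
  have hCm' := hC.card_mono hρ0 hw1 (hw2.trans (h2.trans hr1))
  have hBp := hB.card_pos (r := ρ) (by linarith) (h2.trans hr1)
  have hCp := hC.card_pos (r := ρ) (by linarith) (h2.trans hr1)
  have hprod : (1 - ε) * ((B ρ).card * (C ρ).card : ℝ) ≤
      (B (ρ - r / (2 * M))).card * (C (ρ - r / (2 * M))).card := by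
    calc (1 - ε) * ((B ρ).card * (C ρ).card : ℝ) ≤ (1 - ε) * ((2 : ℝ) ^ ε *
          ((B (ρ - r / (2 * M))).card * (C (ρ - r / (2 * M))).card)) := by
          refine mul_le_mul_of_nonneg_left h3 (by linarith)
      _ = ((1 - ε) * (2 : ℝ) ^ ε) *
          ((B (ρ - r / (2 * M))).card * (C (ρ - r / (2 * M))).card) := by ring
      _ ≤ 1 * ((B (ρ - r / (2 * M))).card * (C (ρ - r / (2 * M))).card) := by gcongr
      _ = _ := one_mul _
  refine ⟨ρ, by linarith, h2, ?_, ?_⟩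
  · refine le_trans (le_of_mul_le_mul_right ?_ hCp) hBm'
    calc (1 - ε) * (B ρ).card * (C ρ).card = (1 - ε) * ((B ρ).card * (C ρ).card : ℝ) := by ring
      _ ≤ _ := hprod
      _ ≤ _ := by gcongr
  · refine le_trans (le_of_mul_le_mul_left ?_ hBp) hCm'
    calc ((B ρ).card : ℝ) * ((1 - ε) * (C ρ).card) = (1 - ε) * ((B ρ).card * (C ρ).card : ℝ) := by
          ring
      _ ≤ _ := hprod
      _ ≤ _ := by gcongr

end Scale

/-! ### Slices, dense translates and progressions -/

section Step

variable {G : Type*} [AddCommGroup G] [DecidableEq G]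

/-- The sum of the two densities is averaged over `z ∈ P`, so one translate serves both scales. -/
theorem exists_common_dense_slice {A P T S₁ S₂ R₁ R₂ : Finset G} {x : G} {α ε : ℝ}
    (hP : P.Nonempty) (hR₁ : R₁.Nonempty) (hR₂ : R₂.Nonempty) (hε : ε ≤ 1)
    (hT : α * P.card ≤ (slice A x T).card)
    (h₁ : ∀ u ∈ T, ∀ s ∈ S₁, u - s ∈ P) (h₂ : ∀ u ∈ T, ∀ s ∈ S₂, u - s ∈ P)
    (hS₁ : (1 - ε) * R₁.card ≤ S₁.card) (hS₂ : (1 - ε) * R₂.card ≤ S₂.card) :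
    ∃ z, 2 * α * (1 - ε) ≤
      (slice A z S₁).card / (R₁.card : ℝ) + (slice A z S₂).card / (R₂.card : ℝ) := by
  have key : ∀ S R : Finset G, R.Nonempty → (∀ u ∈ T, ∀ s ∈ S, u - s ∈ P) →
      (1 - ε) * R.card ≤ S.card →
      P.card * (α * (1 - ε)) ≤ ∑ z ∈ P, (slice A (x + z) S).card / (R.card : ℝ) := by
    intro S R hR h hS
    have hR0 : (0 : ℝ) < R.card := Nat.cast_pos.2 hR.card_pos
    have h1 : ((slice A x T).card * S.card : ℝ) ≤ ∑ z ∈ P, ((slice A (x + z) S).card : ℝ) := by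
      exact_mod_cast card_slice_mul_card_le A x h
    rw [← Finset.sum_div, le_div_iff₀ hR0]
    refine le_trans ?_ h1
    calc P.card * (α * (1 - ε)) * R.card = (α * P.card) * ((1 - ε) * R.card) := by ring
      _ ≤ (slice A x T).card * S.card := by
        have : 0 ≤ (1 - ε) * R.card := mul_nonneg (by linarith) hR0.le
        gcongr
  have h := add_le_add (key S₁ R₁ hR₁ h₁ hS₁) (key S₂ R₂ hR₂ h₂ hS₂)
  rw [← Finset.sum_add_distrib] at h
  have h' : ∑ _z ∈ P, 2 * α * (1 - ε) ≤ ∑ z ∈ P, ((slice A (x + z) S₁).card / (R₁.card : ℝ) +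
      (slice A (x + z) S₂).card / (R₂.card : ℝ)) := by
    rw [Finset.sum_const, nsmul_eq_mul]
    linarith
  obtain ⟨z, _, hz⟩ := Finset.exists_le_of_sum_le hP h'
  exact ⟨x + z, hz⟩

theorem slice_slice_subset (A : Finset G) (z w : G) (S V : Finset G) :
    slice (slice A z S) w V ⊆ slice A (w + z) V := fun s hs => by
  rw [mem_slice, mem_slice] at hs
  exact mem_slice.2 ⟨hs.1, by rw [← add_assoc]; exact hs.2.2⟩

theorem card_image_double_slice {A : Finset G} (hA : ∀ a ∈ A, ∀ a' ∈ A, a + a = a' + a' → a = a')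
    (z : G) (S : Finset G) :
    ((slice A z S).image fun x => x + x).card = (slice A z S).card := by
  refine Finset.card_image_of_injOn fun a ha a' ha' h => ?_
  have h1 := (mem_slice.1 (Finset.mem_coe.1 ha)).2
  have h2 := (mem_slice.1 (Finset.mem_coe.1 ha')).2
  refine add_right_cancel (hA _ h1 _ h2 ?_)
  calc a + z + (a + z) = (a + a) + (z + z) := by abel
    _ = (a' + a') + (z + z) := by rw [show a + a = a' + a' from h]
    _ = _ := by abel

/-- `A` has density at least `α` on a translate of a slightly shrunk copy of `B 1`. -/
def HasDensity (A : Finset G) (B : ℝ → Finset G) (D α : ℝ) : Prop :=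
  α ≤ 1 ∧ ∃ x, α * (B 1).card ≤ (slice A x (B (1 - scaleWidth α D))).card

/-- Regular scales are shrunk by twice `scaleWidth α D` so that the margin still suffices after the
increment: `(17/16)³ ≤ 2`, and a larger dimension only narrows the width. -/
theorem hasDensity_of_le {A : Finset G} {B : ℝ → Finset G} {D D' α w : ℝ} (hD : 1 ≤ D)
    (hα : 0 < α) (hDD : D ≤ D') (hB : CellSystem D' B) (hw : w = 2 * scaleWidth α D) (hw1 : w < 1)
    {x : G} (h : 17 / 16 * α * (B 1).card ≤ (slice A x (B (1 - w))).card) :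
    HasDensity A B D' (17 / 16 * α) := by
  have hw0 : 0 < w := by have := scaleWidth_pos hα hD; linarith
  have hww : scaleWidth (17 / 16 * α) D' ≤ w := by
    rw [hw]
    unfold scaleWidth
    rw [mul_div_assoc']
    gcongr
    have : 0 < α ^ 3 := by positivity
    nlinarith
  have hs0 := scaleWidth_pos (α := 17 / 16 * α) (by positivity) (hD.trans hDD)
  refine ⟨?_, x, h.trans ?_⟩
  · have h1 : ((slice A x (B (1 - w))).card : ℝ) ≤ (B 1).card := Nat.cast_le.2
      (Finset.card_le_card ((slice_subset _ _ _).trans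
        (hB.mono (by linarith) (by linarith) le_rfl)))
    have h2 := hB.card_pos one_pos le_rfl
    exact le_of_mul_le_mul_right (by linarith) h2
  · exact Nat.cast_le.2 (Finset.card_le_card (slice_mono _ _
      (hB.mono (by linarith) (by linarith) (by linarith))))

/-- The proportion of a system retained in one step of the iteration. -/
noncomputable def stepLoss (α D : ℝ) : ℝ :=
  (2 : ℝ) ^ (-(1024 / α ^ 3)) * (α ^ 3 / 8) * (scaleWidth α D ^ 3 / 64) ^ D

variable [Fintype G]

/-- A solution of `x + y = b + b` is the progression `b - t, b, b + t` with `t = b - x`, and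
translating it by `z` puts it in `A`. -/
theorem sum_image_double_slice_le (A : Finset G) (z : G) (S S' : Finset G) :
    ∑ x, ∑ y, indicatorFun (slice A z S) x * indicatorFun (slice A z S) y *
        indicatorFun ((slice A z S').image fun x => x + x) (x + y) ≤
      ∑ y, ∑ x, indicatorFun A (x - y) * indicatorFun A x * indicatorFun A (x + y) := by
  set U := slice A z S with hU
  set U' := slice A z S' with hU'
  have hUA : ∀ w, indicatorFun U w ≤ indicatorFun A (w + z) := fun w => by
    rw [indicatorFun_apply, indicatorFun_apply]
    by_cases hw : w ∈ U
    · simp [hw, (mem_slice.1 hw).2]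
    · simp only [hw, if_false]; split_ifs <;> norm_num
  have hUA' : ∀ w, indicatorFun U' w ≤ indicatorFun A (w + z) := fun w => by
    rw [indicatorFun_apply, indicatorFun_apply]
    by_cases hw : w ∈ U'
    · simp [hw, (mem_slice.1 hw).2]
    · simp only [hw, if_false]; split_ifs <;> norm_num
  have h1 : ∀ t, indicatorFun (U'.image fun x => x + x) t ≤
      ∑ b, indicatorFun U' b * (if b + b = t then 1 else 0) := fun t => by
    rw [sum_indicatorFun_mul, indicatorFun_apply]
    split_ifs with ht
    · obtain ⟨b, hb, hbt⟩ := Finset.mem_image.1 ht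
      refine le_trans (le_of_eq ?_) (Finset.single_le_sum (f := fun b => if b + b = t then (1 : ℝ)
        else 0) (fun b _ => by positivity) hb)
      simp only [if_pos hbt]
    · exact Finset.sum_nonneg fun b _ => by positivity
  calc ∑ x, ∑ y, indicatorFun U x * indicatorFun U y *
        indicatorFun (U'.image fun x => x + x) (x + y)
      ≤ ∑ x, ∑ y, indicatorFun U x * indicatorFun U y *
        ∑ b, indicatorFun U' b * (if b + b = x + y then 1 else 0) := by
        refine Finset.sum_le_sum fun x _ => Finset.sum_le_sum fun y _ => ?_
        exact mul_le_mul_of_nonneg_left (h1 _)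
          (mul_nonneg (indicatorFun_nonneg _ _) (indicatorFun_nonneg _ _))
    _ = ∑ b, ∑ x, indicatorFun U x * indicatorFun U' b * indicatorFun U (b + b - x) := by
        simp only [Finset.mul_sum]
        rw [Finset.sum_congr rfl fun x _ => Finset.sum_comm, Finset.sum_comm]
        refine Finset.sum_congr rfl fun b _ => Finset.sum_congr rfl fun x _ => ?_
        rw [Finset.sum_eq_single (b + b - x) (fun y _ hy => ?_) (by simp)]
        · rw [if_pos (by abel)]; ring
        · rw [if_neg fun h => hy (by rw [h]; abel)]; ring
    _ = ∑ b, ∑ y, indicatorFun U (b - y) * indicatorFun U' b * indicatorFun U (b + y) := by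
        refine Finset.sum_congr rfl fun b _ => ?_
        rw [← Equiv.sum_comp (Equiv.subLeft b)]
        refine Finset.sum_congr rfl fun y _ => ?_
        rw [Equiv.subLeft_apply, show b + b - (b - y) = b + y by abel]
    _ ≤ ∑ b, ∑ y, indicatorFun A (b + z - y) * indicatorFun A (b + z) *
          indicatorFun A (b + z + y) := by
        refine Finset.sum_le_sum fun b _ => Finset.sum_le_sum fun y _ => ?_
        rw [show b + z - y = b - y + z by abel, show b + z + y = b + y + z by abel]
        have := indicatorFun_nonneg U (b - y)
        have := indicatorFun_nonneg U' b
        have := indicatorFun_nonneg U (b + y)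
        have := indicatorFun_nonneg A (b - y + z)
        have := indicatorFun_nonneg A (b + z)
        exact mul_le_mul (mul_le_mul (hUA _) (hUA' _) (by assumption) (by assumption)) (hUA _)
          (by assumption) (by positivity)
    _ = _ := by
        rw [← Equiv.sum_comp (Equiv.addRight (-z)), Finset.sum_comm]
        refine Finset.sum_congr rfl fun y _ => Finset.sum_congr rfl fun b _ => ?_
        simp

end Step

/-! ### One step of the iteration -/

section DensityIncrement

variable {G : Type u} [AddCommGroup G]

theorem CellSystem.card_ge_of_scale {B : ℝ → Finset G} {α D ρ : ℝ} (hB : CellSystem D B) (hα : 0 < α)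
    (hD : 1 ≤ D) (h0 : scaleWidth α D ^ 2 / 8 ≤ ρ) (h1 : ρ ≤ 1) :
    (scaleWidth α D ^ 2 / 16) ^ D * (B 1).card ≤ ((B ρ).card : ℝ) := by
  have hκ := scaleWidth_pos hα hD
  have hρ : 0 < ρ := lt_of_lt_of_le (by positivity) h0
  refine le_trans ?_ (hB.mul_card_le (by linarith) hρ h1 le_rfl)
  exact mul_le_mul_of_nonneg_right
    (Real.rpow_le_rpow (by positivity) (by linarith) (by linarith)) (Nat.cast_nonneg _)

variable [DecidableEq G]

set_option maxHeartbeats 1000000 in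
/-- A dense set either has many solutions on a system, or gains density on a translate of the
intersection of the system with the Bohr set of few frequencies. -/
theorem many_progressions_or_bohr_increment [Fintype G] {A : Finset G} {B : ℝ → Finset G}
    {α D ρ ρ' : ℝ} (hA : ∀ a ∈ A, ∀ a' ∈ A, a + a = a' + a' → a = a') (hB : CellSystem D B)
    (hD : 1 ≤ D) (hα : 0 < α) (hα1 : α ≤ 1) (hρ : 0 < ρ) (hρ1 : ρ ≤ 1) (hρ' : 0 < ρ')
    (hρρ : ρ' ≤ scaleWidth α D * ρ / 2)
    (hreg : (1 - α ^ 3 / 2 ^ 11) * ((B ρ').image fun x => x + x).card ≤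
      (((B (ρ' * (1 - 2 * scaleWidth α D))).image fun x => x + x).card : ℝ)) {z : G}
    (h₁ : 9 / 10 * α * (B ρ).card ≤ (slice A z (B (ρ * (1 - 2 * scaleWidth α D)))).card)
    (h₂ : 9 / 10 * α * (B ρ').card ≤ (slice A z (B (ρ' * (1 - 2 * scaleWidth α D)))).card) :
    α ^ 3 / 8 * (B ρ).card * (B ρ').card ≤
        ∑ y, ∑ x, indicatorFun A (x - y) * indicatorFun A x * indicatorFun A (x + y) ∨
      ∃ B' : ℝ → Finset G, CellSystem (D + 384 / α ^ 3) B' ∧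
        HasDensity A B' (D + 384 / α ^ 3) (17 / 16 * α) ∧
        (2 : ℝ) ^ (-(1024 / α ^ 3)) * ((scaleWidth α D / 4) ^ D * (9 / 10 * α * (B ρ').card)) ≤
          (B' 1).card := by
  set κ := scaleWidth α D with hκ
  have hκ0 : 0 < κ := scaleWidth_pos hα hD
  have hκ1 : κ ≤ 1 / 2 ^ 15 := scaleWidth_le hα hα1 hD
  have hα3 : α ^ 3 ≤ 1 := pow_le_one₀ hα.le hα1
  have hα30 : 0 < α ^ 3 := by positivity
  set C : ℝ → Finset G := fun r => (B r).image fun x => x + x with hC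
  have hCsys : CellSystem D C := hB.image_double
  have hκρ : κ * ρ ≤ 1 / 2 ^ 15 := by
    calc κ * ρ ≤ 1 / 2 ^ 15 * 1 := by gcongr
      _ = 1 / 2 ^ 15 := mul_one _
  have hκρ' : κ * ρ' ≤ ρ' := mul_le_of_le_one_left hρ'.le (by linarith)
  have hρ'1 : ρ' ≤ 1 := by linarith
  set A₂ := slice A z (B (ρ * (1 - 2 * κ))) with hA₂
  set A₃ := slice A z (B (ρ' * (1 - 2 * κ))) with hA₃
  set A' := A₃.image fun x => x + x with hA'
  have hA'card : A'.card = A₃.card := card_image_double_slice hA z _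
  have hw0 : 0 < ρ * (1 - 2 * κ) := mul_pos hρ (by linarith)
  have hw0' : 0 < ρ' * (1 - 2 * κ) := mul_pos hρ' (by linarith)
  have hw1 : ρ * (1 - 2 * κ) ≤ ρ := mul_le_of_le_one_right hρ.le (by linarith)
  have hw1' : ρ' * (1 - 2 * κ) ≤ ρ' := mul_le_of_le_one_right hρ'.le (by linarith)
  have hA₃B : A₃ ⊆ B ρ' := (slice_subset _ _ _).trans (hB.mono hw0' hw1' hρ'1)
  have hA₂B : A₂ ⊆ B ρ := (slice_subset _ _ _).trans (hB.mono hw0 hw1 hρ1)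
  have hA'C : A' ⊆ C ρ' := Finset.image_subset_image hA₃B
  have hBρ := hB.card_pos hρ hρ1
  have hBρ' := hB.card_pos hρ' hρ'1
  have hA₂pos : (0 : ℝ) < A₂.card := lt_of_lt_of_le (by positivity) h₁
  have hCρ' := hCsys.card_pos hρ' hρ'1
  have hCle : ((C ρ').card : ℝ) ≤ (B ρ').card := Nat.cast_le.2 Finset.card_image_le
  set β : ℝ := A₂.card / (B ρ).card with hβ
  have hβα : 9 / 10 * α ≤ β := by rw [hβ, le_div_iff₀ hBρ]; exact h₁
  have hβ0 : 0 < β := lt_of_lt_of_le (by positivity) hβα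
  have hne : (B ρ).Nonempty := ⟨0, hB.zero_mem hρ hρ1⟩
  set S : Finset (AddChar G ℂ) :=
    Finset.univ.filter fun χ => ¬ ‖∑ t ∈ A', χ t‖ ≤ β / 4 * A'.card with hS
  have hsub : ∀ t ∈ A', ∀ a ∈ A₂, t - a ∈ B ρ := by
    intro t ht a ha
    obtain ⟨b, hb, rfl⟩ := Finset.mem_image.1 ht
    have h1 := hB.add_mem_of_le hρ' hρ' (t := 2 * ρ') (by linarith) (by linarith)
      (hA₃B hb) (hA₃B hb)
    rw [sub_eq_add_neg]
    exact hB.add_mem_of_le (by linarith) hw0 (by linarith) hρ1 h1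
      (hB.neg_mem hw0 (hw1.trans hρ1) (slice_subset _ _ _ ha))
  rcases many_solutions_or_large_energy hne hA₂B hsub (S := S)
    (fun χ hχ => by simpa [hS] using hχ) with hcount | henergy
  · left
    refine le_trans ?_ (hcount.trans (sum_image_double_slice_le A z _ _))
    rw [hA'card, ← hβ]
    calc α ^ 3 / 8 * (B ρ).card * (B ρ').card
        ≤ (9 / 10 * α) ^ 2 / 4 * (B ρ).card * (9 / 10 * α * (B ρ').card) := by
          have : (9 / 10 * α) ^ 2 / 4 * (B ρ).card * (9 / 10 * α * (B ρ').card) =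
            729 / 4000 * (α ^ 3 * (B ρ).card * (B ρ').card) := by ring
          rw [this]
          have : 0 < α ^ 3 * (B ρ).card * (B ρ').card := by positivity
          linarith
      _ ≤ β ^ 2 / 4 * (B ρ).card * A₃.card := by gcongr
  right
  -- Chosen so that `M (9α/40)² (9α/10) = 729/250 > 2`, as the spectral cover requires.
  set M : ℝ := 64 / α ^ 3 with hM
  have hM0 : 0 < M := by positivity
  obtain ⟨Λ, hΛcard, hΛ⟩ := exists_spectrum_cover hA'C ⟨0, hCsys.zero_mem hρ' hρ'1⟩
    (S := S) (δ := β / 4) (M := M) (by positivity) hM0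
    (fun χ hχ => (not_le.1 (Finset.mem_filter.1 hχ).2).le) (by
      have h3 : (9 / 10 * α / 4) ^ 2 * (9 / 10 * α * (C ρ').card) ≤ (β / 4) ^ 2 * A'.card := by
        rw [hA'card]
        gcongr
        exact le_trans (by gcongr) h₂
      have h4 : M * ((9 / 10 * α / 4) ^ 2 * (9 / 10 * α * (C ρ').card)) =
          729 / 250 * (C ρ').card := by
        rw [hM]; field_simp; norm_num
      have h5 := mul_le_mul_of_nonneg_left h3 hM0.le
      rw [h4] at h5
      linarith)
  -- This is the margin at scale `ρ'`: translating the shrunken doubled set by an element of `C σ`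
  -- stays inside `C ρ'`. The closeness obtained is `4 (α³/2¹¹) M = 1/8`.
  set σ : ℝ := 2 * κ * ρ' with hσ
  have hσ0 : 0 < σ := by positivity
  have hσρ : 4 * σ ≤ 2 * κ * ρ := by
    rw [hσ]
    have : κ * ρ' ≤ κ * (κ * ρ / 2) := by gcongr
    have : κ * (κ * ρ) ≤ 1 / 2 * (κ * ρ) := by gcongr; linarith
    linarith [mul_pos hκ0 hρ]
  have hσ1 : σ ≤ 1 := by linarith
  have hnear : ∀ x ∈ C σ, ∀ χ ∈ S, ∃ ψ ∈ Λ, ‖(χ - ψ) x - 1‖ ≤ 1 / 8 := by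
    intro x hx χ hχ
    obtain ⟨ψ, hψ, hψ'⟩ := hΛ χ hχ
    refine ⟨ψ, hψ, ?_⟩
    have h3 := norm_map_sub_one_le_of_large_sum (C := C ρ') (C' := C (ρ' * (1 - 2 * κ)))
      (hCsys.mono hw0' hw1' hρ'1) (x := x)
      (fun c hc => hCsys.add_mem_of_le hσ0 hw0' (by rw [hσ]; linarith) hρ'1 hx hc)
      hM0.le hreg hψ' ⟨0, hCsys.zero_mem hρ' hρ'1⟩
    refine h3.trans (le_of_eq ?_)
    rw [hM]; field_simp; norm_num
  set W := bohrInter C σ Λ with hW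
  set D' := D + 384 / α ^ 3 with hD'
  have hDD' : D ≤ D' := by rw [hD']; have : 0 < 384 / α ^ 3 := by positivity
                           linarith
  have hWsys : CellSystem D' W := (hCsys.inter_bohr hσ0 hσ1 Λ).mono_dim (by
    rw [hD', show (384 : ℝ) / α ^ 3 = 6 * M by rw [hM]; ring]
    linarith)
  have hD1' : 1 ≤ D' := hD.trans hDD'
  obtain ⟨τ, hτ0, hτ1, hτ, -⟩ := hWsys.exists_regular_scale hWsys hα hα1 hD1' one_pos le_rfl
  set κ' := scaleWidth α D' with hκ'
  have hκ0' : 0 < κ' := scaleWidth_pos hα hD1'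
  have hκ1' : κ' ≤ 1 / 2 ^ 15 := scaleWidth_le hα hα1 hD1'
  set V := W (τ * (1 - 2 * κ')) with hV
  have hv0 : 0 < τ * (1 - 2 * κ') := mul_pos (by linarith) (by linarith)
  have hv1 : τ * (1 - 2 * κ') ≤ 1 := mul_le_one₀ hτ1 (by linarith) (by linarith)
  have hVC : ∀ v ∈ V, v ∈ C σ := fun v hv =>
    hCsys.mono (by positivity) (mul_le_of_le_one_right hσ0.le hv1) hσ1 (mem_bohrInter.1 hv).1
  have hVB : ∀ v ∈ V, v ∈ B (2 * σ) := fun v hv => by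
    obtain ⟨u, hu, rfl⟩ := Finset.mem_image.1 (hVC v hv)
    exact hB.add_mem_of_le hσ0 hσ0 (by linarith) (by linarith) hu hu
  obtain ⟨w, hw⟩ := exists_increment_of_large_energy (V := V) hne
    (Finset.card_pos.1 (Nat.cast_pos.1 hA₂pos)) ⟨0, hWsys.zero_mem hv0 hv1⟩ (by
      intro a ha v hv v' hv'
      have h3 := hB.add_mem_of_le (t := 4 * σ) (by positivity) (by positivity) (by linarith)
        (by linarith) (hB.neg_mem (by positivity) (by linarith) (hVB v hv)) (hVB v' hv')
      rw [show a - v + v' = a + (-v + v') by abel]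
      exact hB.add_mem_of_le hw0 (by positivity) (by linarith) hρ1 (slice_subset _ _ _ ha) h3)
    (by
      intro χ hχ v hv
      obtain ⟨ψ, hψ, hψ'⟩ := hnear v (hVC v hv) χ hχ
      have h3 := (mem_bohrInter.1 hv).2 ψ hψ
      -- The Bohr condition on the centre `ψ` and the closeness of `χ - ψ` to 1 contribute `1/8`
      -- each.
      have h4 : χ v - 1 = (ψ v - 1) * (χ - ψ) v + ((χ - ψ) v - 1) := by
        have : χ v = ψ v * (χ - ψ) v := by
          rw [← AddChar.add_apply, add_sub_cancel]
        rw [this]; ring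
      rw [h4]
      refine (norm_add_le _ _).trans ?_
      rw [norm_mul, AddChar.norm_apply, mul_one]
      linarith) henergy
  refine ⟨fun r => W (τ * r), hWsys.dilate (by linarith) hτ1, ?_, ?_⟩
  · refine hasDensity_of_le (D := D') hD1' hα le_rfl (hWsys.dilate (by linarith) hτ1)
      (w := 2 * κ') rfl (by linarith) (x := w + z) ?_
    have h3 : ((slice A₂ w V).card : ℝ) ≤ (slice A (w + z) V).card :=
      Nat.cast_le.2 (Finset.card_le_card (slice_slice_subset _ _ _ _ _))
    refine le_trans ?_ (hw.trans h3)
    rw [mul_one, ← hβ]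
    have hWpos := hWsys.card_pos (r := τ) (by linarith) hτ1
    -- The gain `5/4` absorbs the earlier loss `9/10` and the shrinking of `W τ`, since `5/4 · 9/10
    -- = 9/8`.
    calc 17 / 16 * α * (W τ).card
        ≤ 5 / 4 * (9 / 10 * α) * ((1 - 1 / 2 ^ 11) * (W τ).card) := by
          have : 0 < α * (W τ).card := by positivity
          linarith
      _ ≤ 5 / 4 * β * V.card := by
          have : (1 - 1 / 2 ^ 11) * ((W τ).card : ℝ) ≤ V.card := by
            refine le_trans ?_ hτ
            gcongr
          gcongr
  · have h3 := hCsys.card_le_card_bohrInter hσ0 hσ1 Λ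
    have h4 : ((W (1 / 2)).card : ℝ) ≤ (W τ).card := hWsys.card_mono (by norm_num) hτ0 hτ1
    have h5 := hCsys.mul_card_le (by linarith) (s := σ / 4) (r := ρ') (by positivity)
      (by linarith) hρ'1
    have h6 : σ / 4 / (2 * ρ') = κ / 4 := by rw [hσ]; field_simp
    rw [h6] at h5
    -- Doubling may collapse `B ρ'`, but it is injective on the slice of `A`, which keeps `C ρ'`
    -- large.
    have h7 : 9 / 10 * α * (B ρ').card ≤ (C ρ').card := by
      refine h₂.trans ?_
      rw [← hA'card]
      exact Nat.cast_le.2 (Finset.card_le_card hA'C)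
    have h8 : (2 : ℝ) ^ (14 * Λ.card) ≤ (2 : ℝ) ^ (1024 / α ^ 3) := by
      rw [← Real.rpow_natCast]
      refine Real.rpow_le_rpow_of_exponent_le one_le_two ?_
      push_cast
      rw [show (1024 : ℝ) / α ^ 3 = 16 * M by rw [hM]; ring]
      linarith
    rw [Real.rpow_neg two_pos.le, inv_mul_le_iff₀ (by positivity)]
    beta_reduce
    rw [mul_one]
    calc (κ / 4) ^ D * (9 / 10 * α * (B ρ').card) ≤ (κ / 4) ^ D * (C ρ').card := by gcongr
      _ ≤ (C (σ / 4)).card := h5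
      _ ≤ (2 : ℝ) ^ (14 * Λ.card) * (W (1 / 2)).card := h3
      _ ≤ (2 : ℝ) ^ (1024 / α ^ 3) * (W τ).card := by gcongr

/-- One step of the density increment iteration. -/
theorem many_progressions_or_density_increment [Fintype G] {A : Finset G} {B : ℝ → Finset G}
    {α D : ℝ} (hA : ∀ a ∈ A, ∀ a' ∈ A, a + a = a' + a' → a = a') (hB : CellSystem D B)
    (hD : 1 ≤ D) (hα : 0 < α) (hdens : HasDensity A B D α) :
    stepLoss α D * (B 1).card ^ 2 ≤
        ∑ y, ∑ x, indicatorFun A (x - y) * indicatorFun A x * indicatorFun A (x + y) ∨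
      ∃ B' : ℝ → Finset G, CellSystem (D + 384 / α ^ 3) B' ∧
        HasDensity A B' (D + 384 / α ^ 3) (17 / 16 * α) ∧
        stepLoss α D * (B 1).card ≤ (B' 1).card := by
  obtain ⟨hα1, x, hx⟩ := hdens
  set κ := scaleWidth α D with hκ
  have hκ0 : 0 < κ := scaleWidth_pos hα hD
  have hκ1 : κ ≤ 1 / 2 ^ 15 := scaleWidth_le hα hα1 hD
  have hα3 : α ^ 3 ≤ 1 := pow_le_one₀ hα.le hα1
  have hα30 : 0 < α ^ 3 := by positivity
  have hD0 : 0 ≤ D := by linarith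
  obtain ⟨ρ, hρ0, hρ1, hρB, -⟩ := hB.exists_regular_scale hB hα hα1 hD hκ0 (by linarith)
  have hρ : 0 < ρ := by linarith
  have hr' : 0 < κ * ρ / 2 := by positivity
  obtain ⟨ρ', hρ0', hρ1', hρB', hρC'⟩ := hB.exists_regular_scale hB.image_double hα hα1 hD hr'
    (by nlinarith)
  rw [← hκ] at hρB hρB' hρC'
  have hρ' : 0 < ρ' := by linarith
  have hρρ : ρ' ≤ ρ := hρ1'.trans (by nlinarith)
  have hρ2 : ρ ≤ 1 := by linarith
  have hρ2' : ρ' ≤ 1 := by linarith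
  have hBpos := hB.card_pos one_pos le_rfl
  have hBρ := hB.card_pos hρ hρ2
  have hBρ' := hB.card_pos hρ' hρ2'
  -- The margin in `HasDensity` is used here: as `ρ ≤ κ`, subtracting a set of scale at most `ρ`
  -- does not leave `B 1`.
  have hsub : ∀ r, 0 < r → r ≤ ρ → ∀ u ∈ B (1 - κ), ∀ s ∈ B (r * (1 - 2 * κ)), u - s ∈ B 1 := by
    intro r hr hrρ u hu s hs
    have h0 : 0 < r * (1 - 2 * κ) := mul_pos hr (by linarith)
    rw [sub_eq_add_neg]
    exact hB.add_mem_of_le (by linarith) h0 (by nlinarith) le_rfl hu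
      (hB.neg_mem h0 (by nlinarith) hs)
  obtain ⟨z, hz⟩ := exists_common_dense_slice (ε := α ^ 3 / 2 ^ 11)
    ⟨0, hB.zero_mem one_pos le_rfl⟩ ⟨0, hB.zero_mem hρ hρ2⟩ ⟨0, hB.zero_mem hρ' hρ2'⟩
    (by linarith) hx (hsub ρ hρ le_rfl) (hsub ρ' hρ' hρρ) hρB hρB'
  have hlow : (κ ^ 2 / 16) ^ D * (B 1).card ≤ ((B ρ').card : ℝ) :=
    hB.card_ge_of_scale hα hD (by rw [← hκ]; nlinarith) hρ2'
  have hlow' : (κ / 4) ^ D * (B 1).card ≤ ((B ρ).card : ℝ) := by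
    refine le_trans ?_ (hB.mul_card_le hD0 hρ hρ2 le_rfl)
    exact mul_le_mul_of_nonneg_right
      (Real.rpow_le_rpow (by positivity) (by linarith) hD0) (Nat.cast_nonneg _)
  have hprod : (κ ^ 3 / 64) ^ D = (κ / 4) ^ D * (κ ^ 2 / 16) ^ D := by
    rw [← Real.mul_rpow (by positivity) (by positivity)]; ring_nf
  have hp0 : 0 < (κ / 4) ^ D := by positivity
  have hq0 : 0 < (κ ^ 2 / 16) ^ D := by positivity
  have hp1 : (κ / 4) ^ D ≤ 1 := Real.rpow_le_one (by positivity) (by linarith) hD0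
  have htwo : (2 : ℝ) ^ (-(1024 / α ^ 3)) ≤ 1 :=
    Real.rpow_le_one_of_one_le_of_nonpos one_le_two (by
      have : 0 < 1024 / α ^ 3 := by positivity
      linarith)
  have htwo0 : (0 : ℝ) < (2 : ℝ) ^ (-(1024 / α ^ 3)) := by positivity
  have hloss : stepLoss α D =
      (2 : ℝ) ^ (-(1024 / α ^ 3)) * (α ^ 3 / 8) * ((κ / 4) ^ D * (κ ^ 2 / 16) ^ D) := by
    rw [stepLoss, ← hκ, hprod]
  have hdilate : ∀ r, 0 < r → r ≤ 1 → (B ρ').card ≤ ((B r).card : ℝ) →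
      17 / 16 * α * (B r).card ≤ (slice A z (B (r * (1 - 2 * κ)))).card →
      ∃ B' : ℝ → Finset G, CellSystem (D + 384 / α ^ 3) B' ∧
        HasDensity A B' (D + 384 / α ^ 3) (17 / 16 * α) ∧
        stepLoss α D * (B 1).card ≤ (B' 1).card := by
    intro r hr hr1 hrB hrd
    have hDD : D ≤ D + 384 / α ^ 3 := by
      have : 0 < 384 / α ^ 3 := by positivity
      linarith
    have hsys := (hB.dilate hr hr1).mono_dim hDD
    refine ⟨_, hsys, hasDensity_of_le hD hα hDD hsys (w := 2 * κ) rfl (by linarith) (x := z)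
      (by simpa using hrd), ?_⟩
    rw [mul_one]
    refine le_trans ?_ (hlow.trans hrB)
    refine mul_le_mul_of_nonneg_right ?_ hBpos.le
    rw [hloss]
    calc (2 : ℝ) ^ (-(1024 / α ^ 3)) * (α ^ 3 / 8) * ((κ / 4) ^ D * (κ ^ 2 / 16) ^ D)
        ≤ 1 * 1 * (1 * (κ ^ 2 / 16) ^ D) := by gcongr; linarith
      _ = _ := by ring
  rcases le_or_gt (17 / 16 * α * (B ρ).card)
    ((slice A z (B (ρ * (1 - 2 * κ)))).card : ℝ) with hc | hc
  · exact Or.inr (hdilate ρ hρ hρ2 (hB.card_mono hρ' hρρ hρ2) hc)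
  rcases le_or_gt (17 / 16 * α * (B ρ').card)
    ((slice A z (B (ρ' * (1 - 2 * κ)))).card : ℝ) with hc' | hc'
  · exact Or.inr (hdilate ρ' hρ' hρ2' le_rfl hc')
  -- The densities sum to almost `2α` and neither reaches `17/16 α`, so both exceed `9/10 α`.
  have hz' : 2 * α * (1 - 1 / 2 ^ 11) ≤ 2 * α * (1 - α ^ 3 / 2 ^ 11) := by gcongr
  have hd₁ := (div_lt_iff₀ hBρ).2 hc
  have hd₂ := (div_lt_iff₀ hBρ').2 hc'
  rcases many_progressions_or_bohr_increment hA hB hD hα hα1 hρ hρ2 hρ' hρ1' hρC' (z := z)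
    (by rw [← le_div_iff₀ hBρ, ← hκ]; linarith) (by rw [← le_div_iff₀ hBρ', ← hκ]; linarith)
    with h | ⟨B', h1, h2, h3⟩
  · left
    refine le_trans ?_ h
    rw [hloss]
    calc (2 : ℝ) ^ (-(1024 / α ^ 3)) * (α ^ 3 / 8) * ((κ / 4) ^ D * (κ ^ 2 / 16) ^ D) *
          (B 1).card ^ 2
        = (2 : ℝ) ^ (-(1024 / α ^ 3)) * (α ^ 3 / 8 * ((κ / 4) ^ D * (B 1).card) *
          ((κ ^ 2 / 16) ^ D * (B 1).card)) := by ring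
      _ ≤ 1 * (α ^ 3 / 8 * (B ρ).card * (B ρ').card) := by gcongr
      _ = _ := one_mul _
  · refine Or.inr ⟨B', h1, h2, le_trans ?_ h3⟩
    rw [hloss, mul_assoc, mul_assoc]
    refine mul_le_mul_of_nonneg_left ?_ htwo0.le
    calc α ^ 3 / 8 * ((κ / 4) ^ D * (κ ^ 2 / 16) ^ D * (B 1).card)
        = (κ / 4) ^ D * (α ^ 3 / 8 * ((κ ^ 2 / 16) ^ D * (B 1).card)) := by ring
      _ ≤ (κ / 4) ^ D * (9 / 10 * α * (B ρ').card) := by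
        gcongr
        have : α ^ 3 ≤ α := by
          calc α ^ 3 = α * α ^ 2 := by ring
            _ ≤ α * 1 := by gcongr; exact pow_le_one₀ hα.le hα1
            _ = α := mul_one _
        linarith

end DensityIncrement

/-! ### Iterating the increment -/

section Iteration

/-- Each of the three factors of `stepLoss` is at least the `E`-th power of a simpler base; the
product of these bases is `α₀ ^ 12 / (2 ^ 55 * E ^ 3)`. -/
theorem uniform_le_stepLoss {α₀ α D E : ℝ} (hα₀ : 0 < α₀) (h : α₀ ≤ α) (hα1 : α ≤ 1)
    (hD : 1 ≤ D) (hE : D + 2 ^ 12 / α ^ 3 ≤ E) :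
    (α₀ ^ 12 / (2 ^ 55 * E ^ 3)) ^ E ≤ stepLoss α D := by
  have hα : 0 < α := hα₀.trans_le h
  have hα3 : 0 < 2 ^ 12 / α ^ 3 := by positivity
  have hDE : D ≤ E := by linarith
  have hE1 : 1 ≤ E := hD.trans hDE
  have hE0 : 0 < E := by linarith
  set κ := α₀ ^ 3 / (2 ^ 15 * E) with hκ
  have hκ0 : 0 < κ := by positivity
  have hκ1 : κ ≤ scaleWidth α D := by
    unfold scaleWidth
    rw [hκ]
    gcongr
  have hκ2 : κ ≤ 1 := hκ1.trans ((scaleWidth_le hα hα1 hD).trans (by norm_num))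
  have h1 : (1 / 2 : ℝ) ^ E ≤ (2 : ℝ) ^ (-(1024 / α ^ 3)) := by
    rw [one_div, Real.inv_rpow two_pos.le, ← Real.rpow_neg two_pos.le]
    refine Real.rpow_le_rpow_of_exponent_le one_le_two ?_
    have : (2 : ℝ) ^ 12 / α ^ 3 = 4 * (1024 / α ^ 3) := by ring
    have : 0 < 1024 / α ^ 3 := by positivity
    linarith
  have hα₀1 : α₀ ^ 3 ≤ 1 := pow_le_one₀ hα₀.le (h.trans hα1)
  have h2 : (α₀ ^ 3 / 8) ^ E ≤ α ^ 3 / 8 := by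
    calc (α₀ ^ 3 / 8) ^ E ≤ (α₀ ^ 3 / 8) ^ (1 : ℝ) :=
          Real.rpow_le_rpow_of_exponent_ge (by positivity) (by linarith) hE1
      _ = α₀ ^ 3 / 8 := Real.rpow_one _
      _ ≤ α ^ 3 / 8 := by gcongr
  have h3 : (κ ^ 3 / 64) ^ E ≤ (scaleWidth α D ^ 3 / 64) ^ D := by
    have hκ3 : κ ^ 3 ≤ 1 := pow_le_one₀ hκ0.le hκ2
    calc (κ ^ 3 / 64) ^ E ≤ (κ ^ 3 / 64) ^ D :=
          Real.rpow_le_rpow_of_exponent_ge (by positivity) (by linarith) hDE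
      _ ≤ _ := by gcongr
  have h4 : α₀ ^ 12 / (2 ^ 55 * E ^ 3) = 1 / 2 * (α₀ ^ 3 / 8) * (κ ^ 3 / 64) := by
    rw [hκ]; field_simp; norm_num
  rw [h4, Real.mul_rpow (by positivity) (by positivity),
    Real.mul_rpow (by positivity) (by positivity)]
  unfold stepLoss
  gcongr

/-- The quantity `D + 2 ^ 12 / α ^ 3` never increases, so a single `E` bounds the loss of every
step. A step shrinks the system by at most `q`, which enters squared; after `n` increments the
density would exceed 1. -/
theorem le_count_of_hasDensity {G : Type u} [AddCommGroup G] [DecidableEq G] [Fintype G]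
    {A : Finset G} (hA : ∀ a ∈ A, ∀ a' ∈ A, a + a = a' + a' → a = a') {α₀ E : ℝ}
    (hα₀ : 0 < α₀) (n : ℕ) :
    ∀ {α D : ℝ} {B : ℝ → Finset G}, CellSystem D B → 1 ≤ D → α₀ ≤ α → HasDensity A B D α →
      1 < α * (17 / 16) ^ n → D + 2 ^ 12 / α ^ 3 ≤ E →
      ((α₀ ^ 12 / (2 ^ 55 * E ^ 3)) ^ E) ^ (2 * n) * (B 1).card ^ 2 ≤
        ∑ y, ∑ x, indicatorFun A (x - y) * indicatorFun A x * indicatorFun A (x + y) := by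
  induction n with
  | zero =>
    intro α D B _ _ _ hdens hn
    rw [pow_zero, mul_one] at hn
    exact absurd hdens.1 (not_le.2 hn)
  | succ n ih =>
    intro α D B hB hD h hdens hn hE
    have hα : 0 < α := hα₀.trans_le h
    have hα3 : 0 < 1 / α ^ 3 := by positivity
    have e1 : (2 : ℝ) ^ 12 / α ^ 3 = 2 ^ 12 * (1 / α ^ 3) := by ring
    have e2 : (384 : ℝ) / α ^ 3 = 384 * (1 / α ^ 3) := by ring
    have hE0 : 0 < E := by linarith
    set q := (α₀ ^ 12 / (2 ^ 55 * E ^ 3)) ^ E with hq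
    have hq0 : 0 < q := by positivity
    have hqs : q ≤ stepLoss α D := uniform_le_stepLoss hα₀ h hdens.1 hD hE
    have hq1 : q ≤ 1 := by
      refine Real.rpow_le_one (by positivity) ?_ hE0.le
      have : α₀ ^ 12 ≤ 1 := pow_le_one₀ hα₀.le (h.trans hdens.1)
      have hE3 : 1 ≤ E ^ 3 := one_le_pow₀ (by linarith)
      rw [div_le_one (by positivity)]
      linarith
    rcases many_progressions_or_density_increment hA hB hD hα hdens with h1 | ⟨B', h1, h2, h3⟩
    · refine le_trans ?_ h1
      gcongr
      refine le_trans ?_ hqs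
      exact pow_le_of_le_one hq0.le hq1 (by omega)
    · have h4 := ih h1 (by linarith) (by linarith) h2
        (by rw [pow_succ] at hn; linarith) (by
          -- The fall `2¹² (1 - (16/17)³) > 681` pays for the gain of 384 in the dimension.
          have e3 : (2 : ℝ) ^ 12 / (17 / 16 * α) ^ 3 = 2 ^ 12 * (16 / 17) ^ 3 * (1 / α ^ 3) := by
            field_simp
          rw [e3, e2]
          rw [e1] at hE
          linarith)
      refine le_trans ?_ h4
      calc q ^ (2 * (n + 1)) * (B 1).card ^ 2 = q ^ (2 * n) * (q * (B 1).card) ^ 2 := by ring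
        _ ≤ q ^ (2 * n) * (B' 1).card ^ 2 := by
          gcongr
          exact le_trans (by gcongr) h3

end Iteration

/-! ### Initial density, number of steps and final exponents -/

section Main

variable {G : Type*} [AddCommGroup G]

theorem eq_of_add_self_eq {A : Finset G} (hA : ∀ a ∈ A, ∀ a' ∈ A, addOrderOf (a - a') ≠ 2) :
    ∀ a ∈ A, ∀ a' ∈ A, a + a = a' + a' → a = a' := by
  intro a ha a' ha' h
  by_contra hne
  refine hA a ha a' ha' (addOrderOf_eq_prime ?_ (sub_ne_zero.2 hne))
  rw [two_nsmul, sub_add_sub_comm, h, sub_self]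

variable [Fintype G] [DecidableEq G]

theorem exists_slice_card_eq_norm_convUniform {A S : Finset G} (hS : S.Nonempty)
    (hneg : ∀ x ∈ S, -x ∈ S) :
    ∃ y, ((slice A y S).card : ℝ) = ‖convUniform (indicatorFun A) S‖ * S.card := by
  have hS0 : (0 : ℝ) < S.card := Nat.cast_pos.2 hS.card_pos
  have hval : ∀ y, convUniform (indicatorFun A) S y = (slice A y S).card / S.card := fun y => by
    rw [convUniform, slice, Finset.card_filter, div_eq_inv_mul]
    push_cast
    congr 1
    refine Finset.sum_nbij' (fun x => -x) (fun x => -x) hneg hneg (by simp) (by simp)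
      fun x _ => ?_
    rw [indicatorFun_apply, sub_eq_neg_add]
  have hnorm : ∀ y, ‖convUniform (indicatorFun A) S y‖ = (slice A y S).card / S.card := fun y => by
    rw [hval, Real.norm_of_nonneg (by positivity)]
  obtain ⟨y, -, hy⟩ := Finset.exists_max_image Finset.univ
    (fun y => ‖convUniform (indicatorFun A) S y‖) ⟨0, Finset.mem_univ _⟩
  refine ⟨y, ?_⟩
  have : ‖convUniform (indicatorFun A) S‖ = ‖convUniform (indicatorFun A) S y‖ :=
    le_antisymm ((pi_norm_le_iff_of_nonneg (norm_nonneg _)).2 fun x => hy x (Finset.mem_univ _))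
      (norm_le_pi_norm _ y)
  rw [this, hnorm, div_mul_cancel₀ _ hS0.ne']

/-- Regularity at `η = -κ` shows that `B 1` outside `B (1 - κ)` has at most `α / 2 ^ 12` of its
points, so shrinking costs little density. -/
theorem IsRegularBourgainSystem.hasDensity {d α : ℝ} {B : ℝ → Finset G}
    (hB : IsRegularBourgainSystem d B) {A : Finset G} (hα : 0 < α) {y : G}
    (hy : ((slice A y (B 1)).card : ℝ) = α * (B 1).card) :
    HasDensity A B (2 * d) ((1 - 1 / 2 ^ 12) * α) := by
  have hd := hB.one_le_dim
  have hsys := hB.toIsBourgainSystem.cellSystem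
  have hB0 := hsys.card_pos one_pos le_rfl
  have hα1 : α ≤ 1 := by
    refine le_of_mul_le_mul_right ?_ hB0
    rw [← hy, one_mul]
    exact Nat.cast_le.2 (Finset.card_le_card (slice_subset _ _ _))
  set α₀ := (1 - 1 / 2 ^ 12) * α with hα₀
  have hα₀0 : 0 < α₀ := by rw [hα₀]; linarith
  have hα₀α : α₀ ≤ α := by rw [hα₀]; linarith
  refine ⟨by linarith, y, ?_⟩
  have hκ0 := scaleWidth_pos hα₀0 (D := 2 * d) (by linarith)
  have hκ1 := scaleWidth_le hα₀0 (by linarith) (D := 2 * d) (by linarith)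
  set κ := scaleWidth α₀ (2 * d) with hκ
  have hdκ : 2 ^ 3 * d * κ ≤ α / 2 ^ 12 := by
    have h1 : 2 ^ 3 * d * κ = α₀ ^ 3 / 2 ^ 13 := by
      rw [hκ]; unfold scaleWidth; field_simp
    have h2 : α₀ ^ 3 ≤ α₀ := pow_le_of_le_one hα₀0.le (by linarith) (by norm_num)
    rw [h1]
    linarith
  have habs : |(-κ)| = κ := by rw [abs_neg, abs_of_pos hκ0]
  have hreg := (hB.regular (-κ) (by rw [habs]; linarith)).2
  rw [habs, ← sub_eq_add_neg] at hreg
  have hBκ := hsys.card_pos (r := 1 - κ) (by linarith) (by linarith)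
  have hG0 : (0 : ℝ) < Fintype.card G := Nat.cast_pos.2 (Fintype.card_pos_iff.2 ⟨0⟩)
  unfold haarProb at hreg
  rw [div_div_div_cancel_right₀ hG0.ne', div_le_iff₀ hBκ] at hreg
  have hmono := hsys.card_mono (s := 1 - κ) (r := 1) (by linarith) (by linarith) le_rfl
  have hsub : slice A y (B 1) ⊆ slice A y (B (1 - κ)) ∪ (B 1 \ B (1 - κ)) := by
    intro s hs
    rw [mem_slice] at hs
    by_cases h : s ∈ B (1 - κ)
    · exact Finset.mem_union_left _ (mem_slice.2 ⟨h, hs.2⟩)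
    · exact Finset.mem_union_right _ (Finset.mem_sdiff.2 ⟨hs.1, h⟩)
  have hcard : ((slice A y (B 1)).card : ℝ) ≤
      (slice A y (B (1 - κ))).card + ((B 1).card - (B (1 - κ)).card) := by
    have h1 := (Finset.card_le_card hsub).trans (Finset.card_union_le _ _)
    have h2 := Finset.card_sdiff_add_card_eq_card
      (hsys.mono (s := 1 - κ) (r := 1) (by linarith) (by linarith) le_rfl)
    have h3 : ((B 1 \ B (1 - κ)).card : ℝ) + (B (1 - κ)).card = (B 1).card := by
      exact_mod_cast h2
    have h4 : ((slice A y (B 1)).card : ℝ) ≤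
        (slice A y (B (1 - κ))).card + ((B 1 \ B (1 - κ)).card : ℝ) := by exact_mod_cast h1
    linarith
  have h5 : 2 ^ 3 * d * κ * (B (1 - κ)).card ≤ α / 2 ^ 12 * (B 1).card := by gcongr
  rw [hy] at hcard
  rw [hα₀]
  linarith

/-- Since `log (17/16) ≥ 1/17`, slightly more than `17 L` steps suffice. The lower bound on `L`
absorbs the rounding and the constant, also when `α = 1`. -/
theorem exists_iteration_count {α₀ α L : ℝ} (hα : 0 < α) (hα₀ : α₀ = (1 - 1 / 2 ^ 12) * α)
    (hL : Real.log α⁻¹ ≤ L) (hL' : 1 / 2 ^ 12 ≤ L) :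
    ∃ n : ℕ, 1 < α₀ * (17 / 16) ^ n ∧ (n : ℝ) ≤ 2 ^ 14 * L := by
  have hα₀0 : 0 < α₀ := by rw [hα₀]; linarith
  have hlog : (1 / 17 : ℝ) ≤ Real.log (17 / 16) := by
    have := Real.one_sub_inv_le_log_of_pos (x := 17 / 16) (by norm_num)
    norm_num at this ⊢
    exact this
  have hlogα₀ : Real.log α₀⁻¹ ≤ L + 1 / 4095 := by
    rw [hα₀, mul_inv, Real.log_mul (by norm_num) (by positivity)]
    have := Real.log_le_sub_one_of_pos (x := (1 - 1 / 2 ^ 12 : ℝ)⁻¹) (by norm_num)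
    have e : (1 - 1 / 2 ^ 12 : ℝ)⁻¹ - 1 = 1 / 4095 := by norm_num
    linarith
  refine ⟨⌊17 * (L + 1 / 4095)⌋₊ + 1, ?_, ?_⟩
  · have h1 := Nat.lt_floor_add_one (17 * (L + 1 / 4095))
    set m : ℕ := ⌊17 * (L + 1 / 4095)⌋₊ + 1 with hm
    have h2 : Real.log α₀⁻¹ < Real.log ((17 / 16) ^ m) := by
      rw [Real.log_pow]
      have h3 : (m : ℝ) * (1 / 17) ≤ m * Real.log (17 / 16) := by gcongr
      have h4 : 17 * (L + 1 / 4095) < m := by rw [hm]; exact_mod_cast h1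
      linarith
    have h5 := (Real.log_lt_log_iff (by positivity) (by positivity)).1 h2
    rwa [inv_lt_iff_one_lt_mul₀' hα₀0] at h5
  · have h1 := Nat.floor_le (a := 17 * (L + 1 / 4095)) (by linarith)
    push_cast
    linarith

theorem rpow_le_iteration_bound {α₀ α d L : ℝ} {n : ℕ} (hα : 0 < α) (hα1 : α ≤ 1) (hd : 1 ≤ d)
    (hα₀ : α₀ = (1 - 1 / 2 ^ 12) * α) (hL : 1 / 2 ^ 12 ≤ L) (hn : (n : ℝ) ≤ 2 ^ 14 * L) :
    (α / (2 * (1 + d))) ^ ((2 : ℝ) ^ 24 * d * L + (2 : ℝ) ^ 52 * (α ^ 3)⁻¹ * L ^ 2) ≤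
      ((α₀ ^ 12 / (2 ^ 55 * (2 * d + 2 ^ 13 / α ^ 3) ^ 3)) ^ (2 * d + 2 ^ 13 / α ^ 3)) ^
        (2 * n) := by
  set E := 2 * d + 2 ^ 13 / α ^ 3 with hE
  set u := α / (2 * (1 + d)) with hu
  have hu0 : 0 < u := by positivity
  have huα : u ≤ α := div_le_self hα.le (by linarith)
  have hu1 : u ≤ 1 / 4 := by
    rw [hu, div_le_div_iff₀ (by positivity) (by norm_num)]
    linarith
  have hE0 : 0 < E := by positivity
  have hEu : E ≤ 2 ^ 12 / u ^ 3 := by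
    have hα3 : α ^ 3 ≤ 1 := pow_le_one₀ hα.le hα1
    have h1 : 2 ^ 12 / u ^ 3 = 2 ^ 15 * (1 + d) ^ 3 / α ^ 3 := by
      rw [hu]; field_simp
    rw [h1, hE, ← sub_nonneg, show 2 ^ 15 * (1 + d) ^ 3 / α ^ 3 - (2 * d + 2 ^ 13 / α ^ 3) =
      (2 ^ 15 * (1 + d) ^ 3 - (2 * d * α ^ 3 + 2 ^ 13)) / α ^ 3 by field_simp]
    refine div_nonneg ?_ (by positivity)
    have h2 : 2 * d * α ^ 3 ≤ 2 * d := by nlinarith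
    have h3 : 1 + d ≤ (1 + d) ^ 3 := le_self_pow₀ (by linarith) (by norm_num)
    linarith
  have hbase : u ^ 128 ≤ α₀ ^ 12 / (2 ^ 55 * E ^ 3) := by
    have h1 : E ^ 3 ≤ 2 ^ 36 / u ^ 9 := by
      calc E ^ 3 ≤ (2 ^ 12 / u ^ 3) ^ 3 := by gcongr
        _ = 2 ^ 36 / u ^ 9 := by rw [div_pow, ← pow_mul, ← pow_mul]
    have h2 : u ^ 12 / 2 ≤ α₀ ^ 12 := by
      rw [hα₀, mul_pow]
      have h3 : u ^ 12 ≤ α ^ 12 := by gcongr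
      have h4 : (1 / 2 : ℝ) ≤ (1 - 1 / 2 ^ 12) ^ 12 := by norm_num
      calc u ^ 12 / 2 = 1 / 2 * u ^ 12 := by ring
        _ ≤ _ := by gcongr
    -- The factor `u ^ 21` matches `u ^ 12` and `u ^ 9`, and `(1/4) ^ 46 = 2⁻⁹²` pays for `2 · 2⁵⁵ ·
    -- 2³⁶`; `u ^ 61` is spare.
    calc u ^ 128 = u ^ 61 * u ^ 46 * u ^ 21 := by ring
      _ ≤ 1 * (1 / 4) ^ 46 * u ^ 21 := by
        gcongr
        exact pow_le_one₀ hu0.le (by linarith)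
      _ = (u ^ 12 / 2) / (2 ^ 55 * (2 ^ 36 / u ^ 9)) := by field_simp; norm_num
      _ ≤ _ := by gcongr
  calc u ^ ((2 : ℝ) ^ 24 * d * L + (2 : ℝ) ^ 52 * (α ^ 3)⁻¹ * L ^ 2)
      ≤ u ^ ((128 : ℕ) * E * (2 * n : ℕ)) := by
        refine Real.rpow_le_rpow_of_exponent_ge hu0 (by linarith) ?_
        push_cast
        have hα3 : 0 < (α ^ 3)⁻¹ := by positivity
        have hL0 : 0 < L := by linarith [show (0 : ℝ) < 1 / 2 ^ 12 by norm_num]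
        calc 128 * E * (2 * n) ≤ 128 * E * (2 * (2 ^ 14 * L)) := by gcongr
          _ = 2 ^ 23 * (d * L) + 2 ^ 35 * ((α ^ 3)⁻¹ * L) := by rw [hE]; ring
          _ ≤ 2 ^ 24 * (d * L) + 2 ^ 52 * ((α ^ 3)⁻¹ * (L * L)) := by
            -- The argument yields only `α⁻³ L`; the lower bound on `L` turns it into the stated
            -- `α⁻³ L²`.
            have h1 : 1 / 2 ^ 12 * L ≤ L * L := by gcongr
            have h2 : (α ^ 3)⁻¹ * (1 / 2 ^ 12 * L) ≤ (α ^ 3)⁻¹ * (L * L) := by gcongr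
            have h3 : 0 < d * L := by positivity
            have h4 : 0 < (α ^ 3)⁻¹ * L := by positivity
            linarith
          _ = _ := by ring
    _ = ((u ^ 128) ^ E) ^ (2 * n) := by
        rw [Real.rpow_mul hu0.le, Real.rpow_mul hu0.le, Real.rpow_natCast, Real.rpow_natCast]
    _ ≤ _ := by gcongr

end Main

-- `‖·‖` on functions `G → ℝ` is the supremum norm, i.e. the norm of `L^∞(μ_G)` as `G` is finite.
theorem theorem5p1 {G : Type*} [AddCommGroup G] [Fintype G] [DecidableEq G]
    (d : ℝ) (B : ℝ → Finset G) (hB : IsRegularBourgainSystem d B)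
    (A : Finset G) (α : ℝ) (hα : α = ‖convUniform (indicatorFun A) (B 1)‖) (hpos : 0 < α)
    (hA : ∀ a ∈ A, ∀ a' ∈ A, addOrderOf (a - a') ≠ 2) :
    (α / (2 * (1 + d))) ^
        ((2 : ℝ) ^ 24 * d * max (Real.log α⁻¹) (1 / 2 ^ 12) +
          (2 : ℝ) ^ 52 * (α ^ 3)⁻¹ * (max (Real.log α⁻¹) (1 / 2 ^ 12)) ^ 2) *
      bourgainDensity B ^ 2 ≤
    tripleForm (indicatorFun A) (indicatorFun A) (indicatorFun A) := by
  have hd := hB.one_le_dim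
  have hsys := hB.toIsBourgainSystem.cellSystem
  obtain ⟨y, hy⟩ := exists_slice_card_eq_norm_convUniform (A := A)
    ⟨0, hsys.zero_mem one_pos le_rfl⟩ (fun x hx => hsys.neg_mem one_pos le_rfl hx)
  rw [← hα] at hy
  have hdens := hB.hasDensity hpos hy
  have hα1 : α ≤ 1 := by
    refine le_of_mul_le_mul_right ?_ (hsys.card_pos one_pos le_rfl)
    rw [← hy, one_mul]
    exact Nat.cast_le.2 (Finset.card_le_card (slice_subset _ _ _))
  set L := max (Real.log α⁻¹) (1 / 2 ^ 12) with hL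
  have hL1 : Real.log α⁻¹ ≤ L := le_max_left _ _
  have hL2 : 1 / 2 ^ 12 ≤ L := le_max_right _ _
  obtain ⟨n, hn1, hn2⟩ := exists_iteration_count hpos rfl hL1 hL2
  have hcount := le_count_of_hasDensity (eq_of_add_self_eq hA) (by linarith) n hsys
    -- Replacing `2 ^ 12 / α₀ ^ 3` by `2 ^ 13 / α ^ 3` is allowed because `(1 - 2⁻¹²)³ ≥ 1/2`.
    (by linarith) le_rfl hdens hn1 (E := 2 * d + 2 ^ 13 / α ^ 3) (by
      rw [mul_pow, ← div_div]
      gcongr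
      norm_num)
  have hbound := rpow_le_iteration_bound hpos hα1 hd rfl hL2 hn2
  have hG0 : (0 : ℝ) < Fintype.card G := Nat.cast_pos.2 (Fintype.card_pos_iff.2 ⟨0⟩)
  rw [bourgainDensity, haarProb, tripleForm, le_inv_mul_iff₀ (by positivity)]
  refine le_trans (le_of_eq ?_) ((mul_le_mul_of_nonneg_right hbound (sq_nonneg _)).trans hcount)
  field_simp
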